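/- **Setting.** Let $n\ge 1$, $\mathbb T^m=\mathbb R^m/2\pi\mathbb Z^m$, and write the coordinates of $\mathbb T^n\times\mathbb T^1$ as $(t,x)$. Let $\rho,\mu\ge 1$ be integers with $\gcd(\rho,\mu)=1$, and let $c_j=\alpha_j+i\beta_j$ with $\alpha=(\alpha_1,\dots,\alpha_n)$, $\beta=(\beta_1,\dots,\beta_n)\in\mathbb R^n$. For $j=1,\dots,n$ let $P_j(D_x)u=\sum_{\xi\in\mathbb Z}e^{ix\xi}p_j(\xi)\widehat u(t,\xi)$, where $\widehat u(t,\xi)=(2\pi)^{-1}\int_{\mathbb T^1}e^{-ix\xi}u(t,x)\,dx$ and $$p_j(\xi)=c_j|\xi|^{\rho/\mu}\quad(\xi\in\mathbb Z\setminus\{0\}),\qquad p_j(0)\in\mathbb C\ \text{arbitrary}.$$ Put $L_j=-i\,\partial_{t_j}+P_j(D_x)$. For $0\le p\le n$ and a $p$-current $u=\sum_{|K|=p}u_K\,dt_K$ with $u_K\in\mathcal D'(\mathbb T^n\times\mathbb T^1)$, put $$\mathbb L^pu=\sum_{j=1}^n\sum_{|K|=p}(iL_ju_K)\,dt_j\wedge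 dt_K .$$ For $0\le p\le n-1$ let $\mathbb E^p$ be the set of $(p+1)$-forms $f=\sum_{|J|=p+1}f_J\,dt_J$ with $f_J\in C^\infty(\mathbb T^n\times\mathbb T^1)$ such that $\mathbb L^{p+1}f=0$ and such that, for every $\xi\in\mathbb Z$ for which the constant $1$-form $\sum_jp_j(\xi)\,dt_j$ is integral (that is, $\frac1{2\pi}\int_\sigma\sum_jp_j(\xi)\,dt_j\in\mathbb Z$ for every $1$-cycle $\sigma$ in $\mathbb T^n$), the form $\widehat f(t,\xi)\,e^{i\sum_jp_j(\xi)t_j}$ is exact on $\mathbb T^n$. The operator $\mathbb L^p$ is *globally solvable* if for every $f\in\mathbb E^p$ there is a $p$-current $u$ with coefficients in $\mathcal D'(\mathbb T^n\times\mathbb T^1)$ such that $\mathbb L^pu=f$. A vector $\alpha\in\mathbb R^n\setminus\mathbb Q^n$ satisfies $(SDA)_\mu$ if there are $C>0$ and sequences $a_\ell=(a_{1\ell},\dots,a_{n\ell})\in\mathbb Z^n$, $q_\ell\in\mathbb N$ with $q_\ell\ge 2$, such that $$0<\max_{1\le j\le n}\left|\alpha_j^\mu-\frac{(a_{j\ell})^\mu}{q_\ell}\right|<C\,q_\ell^{-\ell}\qquad\text{for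 all }\ell\in\mathbb N .$$ **Theorem.** For each $p=0,1,\dots,n-1$: 1. if $\beta\ne 0$, then $\mathbb L^p$ is globally solvable; 2. if $\beta=0$, then $\mathbb L^p$ is globally solvable if and only if either $\alpha\in\mathbb Q^n$ or $\alpha$ does not satisfy $(SDA)_\mu$. -/

import Mathlib

open scoped ContDiff Real

noncomputable section

namespace TorusComplex

/-! ### Smooth functions on the torus -/

/-- `C^∞(𝕋^m)` for `𝕋^m = ℝ^m / 2πℤ^m`: the smooth functions `ℝ^m → ℂ` that are
`2π`-periodic in every variable. -/
def Smooth (m : ℕ) : Submodule ℂ ((Fin m → ℝ) → ℂ) where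
  carrier := {f | ContDiff ℝ ∞ f ∧
    ∀ (z : Fin m → ℝ) (k : Fin m → ℤ), f (fun i => z i + 2 * π * (k i : ℝ)) = f z}
  add_mem' := by
    rintro f g ⟨hf, hf'⟩ ⟨hg, hg'⟩
    exact ⟨hf.add hg, fun z k => by simp only [Pi.add_apply, hf', hg']⟩
  zero_mem' := ⟨contDiff_const, fun _ _ => rfl⟩
  smul_mem' := by
    rintro c f ⟨hf, hf'⟩
    exact ⟨contDiff_const.smul hf, fun z k => by simp only [Pi.smul_apply, hf']⟩

theorem smooth_differentiable {m : ℕ} (f : Smooth m) : Differentiable ℝ f.1 :=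
  f.2.1.differentiable (by simp)

theorem smooth_continuous {m : ℕ} (f : Smooth m) : Continuous f.1 := f.2.1.continuous

theorem smooth_periodic {m : ℕ} (f : Smooth m) (z : Fin m → ℝ) (k : Fin m → ℤ) :
    f.1 (fun i => z i + 2 * π * (k i : ℝ)) = f.1 z := f.2.2 z k

/-- The partial derivative `∂ / ∂z_i` on `C^∞(𝕋^m)`. -/
def pderiv {m : ℕ} (i : Fin m) : Smooth m →ₗ[ℂ] Smooth m where
  toFun f := ⟨fun z => fderiv ℝ f.1 z (Pi.single i 1), by
    refine ⟨(f.2.1.fderiv_right (m := ∞) (by simp)).clm_apply contDiff_const, fun z k => ?_⟩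
    have h : (fun y : Fin m → ℝ => f.1 (y + fun i => 2 * π * (k i : ℝ))) = f.1 :=
      funext fun y => f.2.2 y k
    have h2 := fderiv_comp_add_right (𝕜 := ℝ) (f := f.1) (x := z) (fun i => 2 * π * (k i : ℝ))
    rw [h] at h2
    exact congrArg (fun A : (Fin m → ℝ) →L[ℝ] ℂ => A (Pi.single i 1)) h2.symm⟩
  map_add' f g := by
    refine Subtype.ext (funext fun z => ?_)
    change fderiv ℝ (f.1 + g.1) z _ = _
    rw [fderiv_add ((smooth_differentiable f) z) ((smooth_differentiable g) z)]
    rfl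
  map_smul' c f := by
    refine Subtype.ext (funext fun z => ?_)
    change fderiv ℝ (c • f.1) z _ = _
    rw [fderiv_const_smul ((smooth_differentiable f) z)]
    rfl

/-- The iterated partial derivative along a list of coordinate directions. -/
def pderivs {m : ℕ} (w : List (Fin m)) : Smooth m →ₗ[ℂ] Smooth m :=
  w.foldr (fun i A => pderiv i ∘ₗ A) LinearMap.id

/-- All partial derivatives of `φ` of order at most `k` are bounded by `M`. -/
def BoundedUpTo {m : ℕ} (k : ℕ) (M : ℝ) (φ : Smooth m) : Prop :=
  ∀ w : List (Fin m), w.length ≤ k → ∀ z, ‖(pderivs w φ).1 z‖ ≤ M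

/-! ### Distributions on the torus -/

/-- `𝒟'(𝕋^m)`: the linear functionals on `C^∞(𝕋^m)` that are continuous for the topology of
uniform convergence of all derivatives, i.e. that are bounded by a constant times
the maximum of the sup norms of the partial derivatives up to some finite order. -/
def Distribution (m : ℕ) : Submodule ℂ (Module.Dual ℂ (Smooth m)) where
  carrier := {u | ∃ (C : ℝ) (k : ℕ), ∀ (φ : Smooth m) (M : ℝ),
    BoundedUpTo k M φ → ‖u φ‖ ≤ C * M}
  add_mem' := by
    rintro u v ⟨C, k, hu⟩ ⟨C', k', hv⟩
    refine ⟨C + C', max k k', fun φ M h => ?_⟩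
    have h1 := hu φ M fun w hw => h w (hw.trans (le_max_left _ _))
    have h2 := hv φ M fun w hw => h w (hw.trans (le_max_right _ _))
    calc ‖(u + v) φ‖ ≤ ‖u φ‖ + ‖v φ‖ := norm_add_le _ _
      _ ≤ (C + C') * M := by linarith
  zero_mem' := ⟨0, 0, fun φ M _ => by simp⟩
  smul_mem' := by
    rintro c u ⟨C, k, hu⟩
    refine ⟨‖c‖ * C, k, fun φ M h => ?_⟩
    have h1 := hu φ M h
    calc ‖(c • u) φ‖ = ‖c‖ * ‖u φ‖ := by simp
      _ ≤ ‖c‖ * (C * M) := by gcongr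
      _ = _ := by ring

/-- Continuity of a linear operator on `C^∞(𝕋^m)`. -/
def IsBoundedOp {m : ℕ} (A : Smooth m →ₗ[ℂ] Smooth m) : Prop :=
  ∀ k : ℕ, ∃ (C : ℝ) (k' : ℕ), ∀ (φ : Smooth m) (M : ℝ),
    BoundedUpTo k' M φ → BoundedUpTo k (C * M) (A φ)

/-- The operator on distributions with `⟨A' u, φ⟩ = ⟨u, A φ⟩`. -/
def transpose {m : ℕ} (A : Smooth m →ₗ[ℂ] Smooth m) (hA : IsBoundedOp A) :
    Distribution m →ₗ[ℂ] Distribution m where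
  toFun u := ⟨u.1 ∘ₗ A, by
    obtain ⟨C, k, hu⟩ := u.2
    obtain ⟨C', k', hA'⟩ := hA k
    refine ⟨C * C', k', fun φ M h => ?_⟩
    rw [mul_assoc]
    exact hu (A φ) (C' * M) (hA' φ M h)⟩
  map_add' _ _ := rfl
  map_smul' _ _ := rfl

theorem pderivs_append {m : ℕ} (w : List (Fin m)) (i : Fin m) (φ : Smooth m) :
    pderivs (w ++ [i]) φ = pderivs w (pderiv i φ) := by
  induction w with
  | nil => rfl
  | cons j w ih =>
    change pderiv j (pderivs (w ++ [i]) φ) = pderiv j (pderivs w (pderiv i φ))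
    rw [ih]

theorem isBoundedOp_neg_pderiv {m : ℕ} (i : Fin m) : IsBoundedOp (-pderiv i) := by
  intro k
  refine ⟨1, k + 1, fun φ M h w hw z => ?_⟩
  have h1 := h (w ++ [i]) (by simpa using hw) z
  rw [pderivs_append] at h1
  have h2 : pderivs w ((-pderiv i) φ) = -pderivs w (pderiv i φ) := by
    rw [LinearMap.neg_apply, map_neg]
  rw [h2, one_mul]
  simpa using h1

/-- The distributional derivative: `⟨∂ᵢ u, φ⟩ = -⟨u, ∂ᵢ φ⟩`. -/
def distDeriv {m : ℕ} (i : Fin m) : Distribution m →ₗ[ℂ] Distribution m :=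
  transpose (-pderiv i) (isBoundedOp_neg_pderiv i)

/-- A smooth function as a distribution: `⟨f, φ⟩ = ∫_{[0,2π]^m} f φ`. -/
def ofSmooth {m : ℕ} (f : Smooth m) : Distribution m :=
  ⟨{ toFun := fun φ => ∫ z in Set.Icc (0 : Fin m → ℝ) (fun _ => 2 * π), f.1 z * φ.1 z
     map_add' := fun φ ψ => by
      rw [← MeasureTheory.integral_add]
      · refine MeasureTheory.integral_congr_ae (Filter.Eventually.of_forall fun z => ?_)
        exact mul_add _ _ _
      · exact ((smooth_continuous f).mul (smooth_continuous φ)).continuousOn.integrableOn_compact isCompact_Icc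
      · exact ((smooth_continuous f).mul (smooth_continuous ψ)).continuousOn.integrableOn_compact isCompact_Icc
     map_smul' := fun c φ => by
      rw [RingHom.id_apply, ← MeasureTheory.integral_smul]
      refine MeasureTheory.integral_congr_ae (Filter.Eventually.of_forall fun z => ?_)
      exact mul_smul_comm c (f.1 z) (φ.1 z) },
   by
    refine ⟨∫ z in Set.Icc (0 : Fin m → ℝ) (fun _ => 2 * π), ‖f.1 z‖, 0, fun φ M h => ?_⟩
    have hφ : ∀ z, ‖φ.1 z‖ ≤ M := fun z => h [] (by simp) z
    rw [← MeasureTheory.integral_mul_const]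
    refine MeasureTheory.norm_integral_le_of_norm_le ?_ (Filter.Eventually.of_forall fun z => ?_)
    · exact ((smooth_continuous f).norm.mul continuous_const).continuousOn.integrableOn_compact
        isCompact_Icc
    · rw [norm_mul]
      exact mul_le_mul_of_nonneg_left (hφ z) (norm_nonneg _)⟩

/-! ### Fourier multipliers in the last variable

Points of `𝕋^n × 𝕋^1` are written `(t, x)`, with `t` the first `n` coordinates
of `Fin (n + 1) → ℝ` and `x` the last one. -/

/-- A symbol on `ℤ`: a function of at most polynomial growth. -/
structure ToroidalSymbol where
  /-- The values of the symbol. -/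
  val : ℤ → ℂ
  growth : ∃ (C : ℝ) (k : ℕ), ∀ ξ : ℤ, ‖val ξ‖ ≤ C * (1 + |(ξ : ℝ)|) ^ k

/-- The symbol `ξ ↦ p(-ξ)`. -/
def ToroidalSymbol.reflect (p : ToroidalSymbol) : ToroidalSymbol where
  val ξ := p.val (-ξ)
  growth := by
    obtain ⟨C, k, h⟩ := p.growth
    exact ⟨C, k, fun ξ => by simpa using h (-ξ)⟩

/-- The partial Fourier coefficient `f̂(t, ξ) = (2π)⁻¹ ∫_0^{2π} e^{-ixξ} f(t, x) dx`. -/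
def partialFourier {n : ℕ} (f : Smooth (n + 1)) (ξ : ℤ) (t : Fin n → ℝ) : ℂ :=
  (2 * π : ℂ)⁻¹ * ∫ x in (0 : ℝ)..(2 * π),
    Complex.exp (-(Complex.I * x * ξ)) * f.1 (Fin.snoc (α := fun _ => ℝ) t x)

/-- The value at `z = (t, x)` of `P(D_x) f = ∑_ξ e^{ixξ} p(ξ) f̂(t, ξ)`. -/
def multiplier {n : ℕ} (p : ToroidalSymbol) (f : Smooth (n + 1)) (z : Fin (n + 1) → ℝ) : ℂ :=
  ∑' ξ : ℤ, Complex.exp (Complex.I * z (Fin.last n) * ξ) * p.val ξ *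
    partialFourier f ξ (fun j => z j.castSucc)

/-! The next facts show that `multiplier p f` is again smooth and depends continuously on `f`. -/

/-- The summand `e^{ixξ} f̂(t, ξ)`, as an integral over translates of `f`. -/
def mode {n : ℕ} (f : Smooth (n + 1)) (ξ : ℤ) (z : Fin (n + 1) → ℝ) : ℂ :=
  (2 * π : ℂ)⁻¹ * ∫ s in (0 : ℝ)..(2 * π),
    Complex.exp (-(Complex.I * s * ξ)) * f.1 (z + s • Pi.single (Fin.last n) (1 : ℝ))

theorem mode_eq {n : ℕ} (f : Smooth (n + 1)) (ξ : ℤ) (z : Fin (n + 1) → ℝ) :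
    Complex.exp (Complex.I * z (Fin.last n) * ξ) * partialFourier f ξ (fun j => z j.castSucc) =
      mode f ξ z := by
  have hz : ∀ x : ℝ, (Fin.snoc (α := fun _ => ℝ) (fun j => z j.castSucc) x : Fin (n + 1) → ℝ) =
      z + (x - z (Fin.last n)) • Pi.single (Fin.last n) (1 : ℝ) := by
    intro x
    funext i
    refine Fin.lastCases ?_ (fun j => ?_) i
    · simp
    · simp
  set F : ℝ → ℂ := fun x => Complex.exp (-(Complex.I * x * ξ)) *
    f.1 (Fin.snoc (α := fun _ => ℝ) (fun j => z j.castSucc) x) with hF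
  have hper : Function.Periodic F (2 * π) := by
    intro x
    simp only [hF]
    congr 1
    · rw [Complex.exp_eq_exp_iff_exists_int]
      exact ⟨-ξ, by push_cast; ring⟩
    · rw [← (smooth_periodic f) (Fin.snoc (α := fun _ => ℝ) (fun j => z j.castSucc) x)
        (Pi.single (Fin.last n) 1)]
      refine congrArg f.1 (funext fun i => ?_)
      refine Fin.lastCases ?_ (fun j => ?_) i
      · simp
      · simp [(Fin.castSucc_lt_last j).ne]
  have h1 : ∫ x in (0 : ℝ)..(2 * π), F x = ∫ s in (0 : ℝ)..(2 * π), F (s + z (Fin.last n)) := by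
    rw [intervalIntegral.integral_comp_add_right]
    have := hper.intervalIntegral_add_eq 0 (0 + z (Fin.last n))
    rw [zero_add] at this
    rw [this, zero_add, add_comm (2 * π)]
  have h2 : partialFourier f ξ (fun j => z j.castSucc) =
      (2 * π : ℂ)⁻¹ * ∫ s in (0 : ℝ)..(2 * π), F (s + z (Fin.last n)) := by
    rw [← h1]
    rfl
  rw [h2, mode, mul_left_comm, ← intervalIntegral.integral_const_mul]
  congr 1
  refine intervalIntegral.integral_congr fun s _ => ?_
  simp only [hF, hz]
  rw [← mul_assoc, ← Complex.exp_add]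
  congr 2
  · push_cast
    ring
  · simp

theorem norm_exp_aux (s : ℝ) (ξ : ℤ) : ‖Complex.exp (-(Complex.I * s * ξ))‖ = 1 := by
  have : -(Complex.I * s * ξ) = ((-(s * ξ) : ℝ) : ℂ) * Complex.I := by push_cast; ring
  rw [this, Complex.norm_exp_ofReal_mul_I]

theorem norm_mode_le {n : ℕ} (f : Smooth (n + 1)) (M : ℝ) (h : ∀ z, ‖f.1 z‖ ≤ M) (ξ : ℤ)
    (z : Fin (n + 1) → ℝ) : ‖mode f ξ z‖ ≤ M := by
  have hpi := Real.pi_pos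
  have h1 : ‖∫ s in (0 : ℝ)..(2 * π),
      Complex.exp (-(Complex.I * s * ξ)) * f.1 (z + s • Pi.single (Fin.last n) (1 : ℝ))‖
      ≤ M * |2 * π - 0| := by
    refine intervalIntegral.norm_integral_le_of_norm_le_const fun s _ => ?_
    rw [norm_mul, norm_exp_aux, one_mul]
    exact h _
  rw [sub_zero, abs_of_pos (by positivity)] at h1
  have h3 : ‖(2 * π : ℂ)⁻¹‖ = (2 * π)⁻¹ := by
    rw [norm_inv, norm_mul, Complex.norm_ofNat, Complex.norm_real, Real.norm_of_nonneg hpi.le]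
  rw [mode, norm_mul, h3]
  calc (2 * π)⁻¹ * _ ≤ (2 * π)⁻¹ * (M * (2 * π)) := by gcongr
    _ = M := by field_simp

theorem smooth_exists_bound {m : ℕ} (f : Smooth m) : ∃ B : ℝ, ∀ z, ‖f.1 z‖ ≤ B := by
  have hpi : 0 < 2 * π := by positivity
  obtain ⟨B, hB⟩ := (isCompact_Icc (a := (0 : Fin m → ℝ)) (b := fun _ => 2 * π)).exists_bound_of_continuousOn
    (smooth_continuous f).continuousOn
  refine ⟨B, fun z => ?_⟩
  rw [← (smooth_periodic f) z (fun i => -⌊z i / (2 * π)⌋)]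
  refine hB _ ⟨fun i => ?_, fun i => ?_⟩
  · have := Int.floor_le (z i / (2 * π))
    rw [le_div_iff₀ hpi] at this
    simp only [Pi.zero_apply, Int.cast_neg]
    linarith
  · have := (Int.lt_floor_add_one (z i / (2 * π))).le
    rw [div_le_iff₀ hpi] at this
    simp only [Int.cast_neg]
    linarith

theorem fderiv_eq_sum {m : ℕ} (f : Smooth m) (z : Fin m → ℝ) :
    fderiv ℝ f.1 z = ∑ i, (ContinuousLinearMap.proj (R := ℝ) (φ := fun _ : Fin m => ℝ) i).smulRight
      ((pderiv i f).1 z) := by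
  ext v
  conv_lhs => rw [← Finset.univ_sum_single v, map_sum]
  rw [sum_apply]
  refine Finset.sum_congr rfl fun i _ => ?_
  have : (Pi.single i (v i) : Fin m → ℝ) = v i • Pi.single i (1 : ℝ) := by
    rw [← Pi.single_smul, smul_eq_mul, mul_one]
  rw [this, map_smul]
  rfl

theorem mode_continuous_aux {n : ℕ} (f : Smooth (n + 1)) (ξ : ℤ) (z : Fin (n + 1) → ℝ) :
    Continuous fun s : ℝ => Complex.exp (-(Complex.I * s * ξ)) *
      f.1 (z + s • Pi.single (Fin.last n) (1 : ℝ)) := by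
  have := (smooth_continuous f)
  fun_prop

theorem hasFDerivAt_mode {n : ℕ} (f : Smooth (n + 1)) (ξ : ℤ) (z : Fin (n + 1) → ℝ) :
    HasFDerivAt (mode f ξ) (∑ i, (ContinuousLinearMap.proj (R := ℝ)
      (φ := fun _ : Fin (n + 1) => ℝ) i).smulRight (mode (pderiv i f) ξ z)) z := by
  choose B hB using fun i => (smooth_exists_bound (pderiv i f))
  set e : ℝ → (Fin (n + 1) → ℝ) := fun s => s • Pi.single (Fin.last n) (1 : ℝ) with he
  set F' : (Fin (n + 1) → ℝ) → ℝ → ((Fin (n + 1) → ℝ) →L[ℝ] ℂ) := fun z s =>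
    ∑ i, (ContinuousLinearMap.proj (R := ℝ) (φ := fun _ : Fin (n + 1) => ℝ) i).smulRight
      (Complex.exp (-(Complex.I * s * ξ)) * (pderiv i f).1 (z + e s)) with hF'
  have hcont : Continuous (F' z) := by
    refine continuous_finsetSum _ fun i _ => ?_
    exact (ContinuousLinearMap.smulRightL ℝ _ ℂ _).continuous.comp
      (mode_continuous_aux (pderiv i f) ξ z)
  have key := intervalIntegral.hasFDerivAt_integral_of_dominated_of_fderiv_le
    (μ := MeasureTheory.volume) (𝕜 := ℝ) (a := 0) (b := 2 * π) (x₀ := z) (s := Set.univ)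
    (F := fun z s => Complex.exp (-(Complex.I * s * ξ)) * f.1 (z + e s)) (F' := F')
    (bound := fun _ => ∑ i, B i) Filter.univ_mem
    (Filter.Eventually.of_forall fun y =>
      (mode_continuous_aux f ξ y).aestronglyMeasurable)
    ((mode_continuous_aux f ξ z).intervalIntegrable _ _)
    hcont.aestronglyMeasurable
    (Filter.Eventually.of_forall fun s _ y _ => by
      refine ContinuousLinearMap.opNorm_le_bound _
        (Finset.sum_nonneg fun i _ => (norm_nonneg _).trans (hB i 0)) fun v => ?_
      rw [hF', sum_apply, Finset.sum_mul]
      refine norm_sum_le_of_le _ fun i _ => ?_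
      rw [ContinuousLinearMap.smulRight_apply, norm_smul, norm_mul, norm_exp_aux, one_mul, mul_comm]
      exact mul_le_mul (hB i _) (norm_le_pi_norm v i) (norm_nonneg _)
        ((norm_nonneg _).trans (hB i 0)))
    (by simp)
    (Filter.Eventually.of_forall fun s _ y _ => by
      have h1 : HasFDerivAt (fun y => f.1 (y + e s)) (fderiv ℝ f.1 (y + e s)) y := by
        rw [hasFDerivAt_comp_add_right]
        exact ((smooth_differentiable f) _).hasFDerivAt
      have h2 := h1.const_mul (Complex.exp (-(Complex.I * s * ξ)))
      refine h2.congr_fderiv ?_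
      symm
      rw [fderiv_eq_sum, Finset.smul_sum]
      refine Finset.sum_congr rfl fun i _ => ?_
      ext v
      simp only [ContinuousLinearMap.smulRight_apply, smul_apply,
        smul_eq_mul]
      rw [mul_smul_comm])
  have h3 := key.const_mul ((2 * π : ℂ)⁻¹)
  refine h3.congr_fderiv ?_
  have hint : IntervalIntegrable (F' z) MeasureTheory.volume 0 (2 * π) :=
    hcont.intervalIntegrable _ _
  ext v
  rw [smul_apply, ContinuousLinearMap.intervalIntegral_apply hint,
    sum_apply]
  simp only [hF', sum_apply, ContinuousLinearMap.smulRight_apply,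
    ContinuousLinearMap.proj_apply]
  rw [intervalIntegral.integral_finsetSum (f := fun i s => v i •
    (Complex.exp (-(Complex.I * s * ξ)) * (pderiv i f).1 (z + e s))) fun i _ =>
    ((mode_continuous_aux (pderiv i f) ξ z).const_smul (v i)).intervalIntegrable _ _,
    Finset.smul_sum]
  refine Finset.sum_congr rfl fun i _ => ?_
  rw [intervalIntegral.integral_smul, smul_comm]
  rfl

theorem mode_pderiv_last {n : ℕ} (f : Smooth (n + 1)) (ξ : ℤ) (z : Fin (n + 1) → ℝ) :
    mode (pderiv (Fin.last n) f) ξ z = Complex.I * ξ * mode f ξ z := by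
  set e : ℝ → (Fin (n + 1) → ℝ) := fun s => s • Pi.single (Fin.last n) (1 : ℝ) with he
  have hu : ∀ s : ℝ, HasDerivAt (fun s : ℝ => Complex.exp (-(Complex.I * s * ξ)))
      (Complex.exp (-(Complex.I * s * ξ)) * (-(Complex.I * ξ))) s := by
    intro s
    have h1 : HasDerivAt (fun s : ℝ => -(Complex.I * s * ξ)) (-(Complex.I * ξ)) s := by
      have := (((Complex.ofRealCLM.hasDerivAt (x := s)).const_mul Complex.I).mul_const (ξ : ℂ)).neg
      simp only [Complex.ofRealCLM_apply, Complex.ofReal_one, mul_one] at this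
      exact this
    exact h1.cexp
  have hv : ∀ s : ℝ, HasDerivAt (fun s : ℝ => f.1 (z + e s))
      ((pderiv (Fin.last n) f).1 (z + e s)) s := by
    intro s
    have h1 : HasDerivAt (fun s : ℝ => z + e s) (Pi.single (Fin.last n) (1 : ℝ)) s := by
      have := ((hasDerivAt_id s).smul_const
        (Pi.single (Fin.last n) (1 : ℝ) : Fin (n + 1) → ℝ)).const_add z
      simpa using this
    exact ((smooth_differentiable f) (z + e s)).hasFDerivAt.comp_hasDerivAt s h1
  have h := intervalIntegral.integral_mul_deriv_eq_deriv_mul (a := 0) (b := 2 * π)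
    (fun s _ => hu s) (fun s _ => hv s)
    (by apply Continuous.intervalIntegrable; fun_prop)
    (by
      apply Continuous.intervalIntegrable
      have := (smooth_continuous (pderiv (Fin.last n) f))
      fun_prop)
  have hb : f.1 (z + e (2 * π)) = f.1 (z + e 0) := by
    rw [← (smooth_periodic f) (z + e 0) (Pi.single (Fin.last n) 1)]
    refine congrArg f.1 (funext fun i => ?_)
    refine Fin.lastCases ?_ (fun j => ?_) i
    · simp [he]
    · simp [he, (Fin.castSucc_lt_last j).ne]
  have hc : Complex.exp (-(Complex.I * ((2 * π : ℝ) : ℂ) * ξ)) =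
      Complex.exp (-(Complex.I * ((0 : ℝ) : ℂ) * ξ)) := by
    rw [Complex.exp_eq_exp_iff_exists_int]
    exact ⟨-ξ, by push_cast; ring⟩
  rw [hb, hc, sub_self, zero_sub] at h
  rw [mode, mode, h, mul_left_comm, ← intervalIntegral.integral_const_mul (Complex.I * ξ),
    ← intervalIntegral.integral_neg]
  congr 1
  refine intervalIntegral.integral_congr fun s _ => ?_
  simp only [he]
  ring

theorem norm_mode_mul_pow_le {n : ℕ} (k : ℕ) : ∀ (f : Smooth (n + 1)) (M : ℝ),
    BoundedUpTo k M f → ∀ (ξ : ℤ) (z : Fin (n + 1) → ℝ), |(ξ : ℝ)| ^ k * ‖mode f ξ z‖ ≤ M := by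
  induction k with
  | zero =>
    intro f M h ξ z
    simpa using norm_mode_le f M (fun z => h [] (by simp) z) ξ z
  | succ k ih =>
    intro f M h ξ z
    have h1 := ih (pderiv (Fin.last n) f) M (fun w hw z => by
      rw [← pderivs_append]
      exact h _ (by simpa using hw) z) ξ z
    rw [mode_pderiv_last, norm_mul, norm_mul, Complex.norm_I, one_mul, Complex.norm_intCast] at h1
    rw [pow_succ, mul_assoc]
    exact h1

theorem norm_mode_decay {n : ℕ} (k : ℕ) (f : Smooth (n + 1)) (M : ℝ) (h : BoundedUpTo k M f)
    (ξ : ℤ) (z : Fin (n + 1) → ℝ) : (1 + |(ξ : ℝ)|) ^ k * ‖mode f ξ z‖ ≤ 2 ^ k * M := by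
  have h0 : ‖mode f ξ z‖ ≤ M := norm_mode_le f M (fun z => h [] (by simp) z) ξ z
  have hk := norm_mode_mul_pow_le k f M h ξ z
  rcases le_total |(ξ : ℝ)| 1 with hξ | hξ
  · calc (1 + |(ξ : ℝ)|) ^ k * ‖mode f ξ z‖ ≤ 2 ^ k * ‖mode f ξ z‖ := by
          gcongr
          linarith
      _ ≤ 2 ^ k * M := by gcongr
  · calc (1 + |(ξ : ℝ)|) ^ k * ‖mode f ξ z‖ ≤ (2 * |(ξ : ℝ)|) ^ k * ‖mode f ξ z‖ := by
          gcongr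
          linarith
      _ = 2 ^ k * (|(ξ : ℝ)| ^ k * ‖mode f ξ z‖) := by rw [mul_pow, mul_assoc]
      _ ≤ 2 ^ k * M := by gcongr

theorem summable_weight : Summable fun ξ : ℤ => ((1 + |(ξ : ℝ)|) ^ 2)⁻¹ := by
  refine Summable.of_norm_bounded_eventually (Real.summable_one_div_int_pow.mpr one_lt_two) ?_
  refine (Filter.eventually_cofinite_ne (0 : ℤ)).mono fun ξ hξ => ?_
  have h1 : 0 < |(ξ : ℝ)| := abs_pos.mpr (Int.cast_ne_zero.mpr hξ)
  rw [Real.norm_of_nonneg (by positivity), one_div, ← sq_abs (ξ : ℝ)]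
  gcongr
  linarith

theorem smooth_exists_boundedUpTo {m : ℕ} (k : ℕ) : ∀ f : Smooth m,
    ∃ M : ℝ, BoundedUpTo k M f := by
  induction k with
  | zero =>
    intro f
    obtain ⟨B, hB⟩ := (smooth_exists_bound f)
    refine ⟨B, fun w hw z => ?_⟩
    rw [List.length_eq_zero_iff.mp (Nat.le_zero.mp hw)]
    exact hB z
  | succ k ih =>
    intro f
    obtain ⟨B, hB⟩ := (smooth_exists_bound f)
    choose M hM using fun i => ih (pderiv i f)
    refine ⟨max B (∑ i, M i), fun w hw z => ?_⟩
    rcases List.eq_nil_or_concat w with rfl | ⟨w', i, rfl⟩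
    · exact (hB z).trans (le_max_left _ _)
    · rw [List.concat_eq_append, pderivs_append]
      refine (hM i w' (by simpa using hw) z).trans (le_trans ?_ (le_max_right _ _))
      exact Finset.single_le_sum (f := M)
        (fun j _ => (norm_nonneg _).trans (hM j [] (by simp) 0)) (Finset.mem_univ i)

/-- The series of the multiplier is dominated, uniformly in `z`, by a summable one. -/
theorem exists_multiplier_bound (n : ℕ) (p : ToroidalSymbol) : ∃ (C : ℝ) (k : ℕ),
    ∀ (f : Smooth (n + 1)) (M : ℝ), BoundedUpTo k M f → ∀ (ξ : ℤ) (z : Fin (n + 1) → ℝ),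
      ‖p.val ξ * mode f ξ z‖ ≤ C * M * ((1 + |(ξ : ℝ)|) ^ 2)⁻¹ := by
  obtain ⟨C, k, hp⟩ := p.growth
  have hC : 0 ≤ C := by simpa using (norm_nonneg _).trans (hp 0)
  refine ⟨C * 2 ^ (k + 2), k + 2, fun f M h ξ z => ?_⟩
  have h1 := norm_mode_decay (k + 2) f M h ξ z
  rw [← div_eq_mul_inv, le_div_iff₀ (by positivity), norm_mul]
  calc ‖p.val ξ‖ * ‖mode f ξ z‖ * (1 + |(ξ : ℝ)|) ^ 2
      ≤ C * (1 + |(ξ : ℝ)|) ^ k * ‖mode f ξ z‖ * (1 + |(ξ : ℝ)|) ^ 2 := by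
        gcongr
        exact hp ξ
    _ = C * ((1 + |(ξ : ℝ)|) ^ (k + 2) * ‖mode f ξ z‖) := by ring
    _ ≤ C * (2 ^ (k + 2) * M) := by gcongr
    _ = _ := by ring

theorem multiplier_eq {n : ℕ} (p : ToroidalSymbol) (f : Smooth (n + 1)) :
    multiplier p f = fun z => ∑' ξ : ℤ, p.val ξ * mode f ξ z := by
  funext z
  refine tsum_congr fun ξ => ?_
  rw [← mode_eq]
  ring

theorem summable_multiplier {n : ℕ} (p : ToroidalSymbol) (f : Smooth (n + 1))
    (z : Fin (n + 1) → ℝ) : Summable fun ξ : ℤ => p.val ξ * mode f ξ z := by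
  obtain ⟨C, k, hC⟩ := exists_multiplier_bound n p
  obtain ⟨M, hM⟩ := smooth_exists_boundedUpTo k f
  exact Summable.of_norm_bounded (summable_weight.mul_left (C * M)) fun ξ => hC f M hM ξ z

theorem hasFDerivAt_multiplier {n : ℕ} (p : ToroidalSymbol) (f : Smooth (n + 1))
    (z : Fin (n + 1) → ℝ) :
    HasFDerivAt (multiplier p f) (∑ i, (ContinuousLinearMap.proj (R := ℝ)
      (φ := fun _ : Fin (n + 1) => ℝ) i).smulRight (multiplier p (pderiv i f) z)) z := by
  obtain ⟨C, k, hC⟩ := exists_multiplier_bound n p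
  choose M hM using fun i => smooth_exists_boundedUpTo k (pderiv i f)
  set T : (Fin (n + 1)) → ℂ →L[ℝ] ((Fin (n + 1) → ℝ) →L[ℝ] ℂ) := fun i =>
    ContinuousLinearMap.smulRightL ℝ (Fin (n + 1) → ℝ) ℂ
      (ContinuousLinearMap.proj (R := ℝ) (φ := fun _ : Fin (n + 1) => ℝ) i) with hT
  have h := hasFDerivAt_tsum (𝕜 := ℝ) (f := fun (ξ : ℤ) z => p.val ξ * mode f ξ z)
    (f' := fun (ξ : ℤ) z => ∑ i, T i (p.val ξ * mode (pderiv i f) ξ z))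
    (u := fun ξ : ℤ => ∑ i, ‖T i‖ * (C * M i * ((1 + |(ξ : ℝ)|) ^ 2)⁻¹)) (x₀ := z)
    (summable_sum fun i _ => (summable_weight.mul_left _).mul_left _)
    (fun ξ y => by
      refine ((hasFDerivAt_mode f ξ y).const_mul (p.val ξ)).congr_fderiv ?_
      symm
      rw [Finset.smul_sum]
      refine Finset.sum_congr rfl fun i _ => ?_
      ext v
      change v i • (p.val ξ * mode (pderiv i f) ξ y) = p.val ξ • (v i • mode (pderiv i f) ξ y)
      rw [smul_eq_mul, mul_smul_comm])
    (fun ξ y => norm_sum_le_of_le _ fun i _ => ((T i).le_opNorm _).trans (by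
      gcongr
      exact hC _ _ (hM i) ξ y))
    (summable_multiplier p f z) z
  rw [multiplier_eq]
  refine h.congr_fderiv ?_
  rw [Summable.tsum_finsetSum fun i _ => (T i).summable (summable_multiplier p (pderiv i f) z)]
  refine Finset.sum_congr rfl fun i _ => ?_
  rw [← (T i).map_tsum (summable_multiplier p (pderiv i f) z), multiplier_eq]
  rfl

theorem contDiff_multiplier {n : ℕ} (p : ToroidalSymbol) (N : ℕ) : ∀ f : Smooth (n + 1),
    ContDiff ℝ N (multiplier p f) := by
  induction N with
  | zero =>
    intro f
    exact contDiff_zero.mpr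
      (continuous_iff_continuousAt.mpr fun z => (hasFDerivAt_multiplier p f z).continuousAt)
  | succ N ih =>
    intro f
    rw [Nat.cast_succ, contDiff_succ_iff_fderiv_apply]
    refine ⟨fun z => (hasFDerivAt_multiplier p f z).differentiableAt, by simp, fun v => ?_⟩
    have : (fun z => fderiv ℝ (multiplier p f) z v) =
        fun z => ∑ i, v i • multiplier p (pderiv i f) z := by
      funext z
      rw [(hasFDerivAt_multiplier p f z).fderiv, sum_apply]
      rfl
    rw [this]
    exact ContDiff.sum fun i _ => contDiff_const.smul (f := fun _ => v i) (ih (pderiv i f))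

/-- The pseudo-differential operator `P(D_x) f = ∑_ξ e^{ixξ} p(ξ) f̂(t, ξ)` on `C^∞(𝕋^n × 𝕋^1)`. -/
def pdoSmooth (n : ℕ) (p : ToroidalSymbol) : Smooth (n + 1) →ₗ[ℂ] Smooth (n + 1) where
  toFun f := ⟨multiplier p f, contDiff_infty.mpr fun N => contDiff_multiplier p N f, fun z k => by
    simp only [multiplier_eq]
    refine tsum_congr fun ξ => ?_
    rw [mode, mode]
    congr 2
    refine intervalIntegral.integral_congr fun s _ => ?_
    refine congrArg (Complex.exp (-(Complex.I * s * ξ)) * ·) ?_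
    refine Eq.trans (congrArg f.1 (funext fun i => ?_)) (smooth_periodic f _ k)
    simp only [Pi.add_apply]
    ring⟩
  map_add' f g := by
    refine Subtype.ext ?_
    change multiplier p (f + g) = multiplier p f + multiplier p g
    funext z
    simp only [multiplier_eq, Pi.add_apply]
    rw [← (summable_multiplier p f z).tsum_add (summable_multiplier p g z)]
    refine tsum_congr fun ξ => ?_
    rw [mode, mode, mode, ← mul_add, ← mul_add, ← intervalIntegral.integral_add
      ((mode_continuous_aux f ξ z).intervalIntegrable _ _)
      ((mode_continuous_aux g ξ z).intervalIntegrable _ _)]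
    congr 2
    refine intervalIntegral.integral_congr fun s _ => ?_
    exact mul_add _ _ _
  map_smul' c f := by
    refine Subtype.ext ?_
    change multiplier p (c • f) = c • multiplier p f
    funext z
    simp only [multiplier_eq, Pi.smul_apply, smul_eq_mul]
    rw [← tsum_mul_left]
    refine tsum_congr fun ξ => ?_
    rw [mode, mode, mul_left_comm c, mul_left_comm c, ← intervalIntegral.integral_const_mul c]
    congr 2
    refine intervalIntegral.integral_congr fun s _ => ?_
    exact mul_left_comm _ _ _

theorem pderiv_pdoSmooth {n : ℕ} (p : ToroidalSymbol) (i : Fin (n + 1)) (f : Smooth (n + 1)) :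
    pderiv i (pdoSmooth n p f) = pdoSmooth n p (pderiv i f) := by
  refine Subtype.ext (funext fun z => ?_)
  change fderiv ℝ (multiplier p f) z (Pi.single i 1) = multiplier p (pderiv i f) z
  rw [(hasFDerivAt_multiplier p f z).fderiv, sum_apply, Finset.sum_eq_single i]
  · simp
  · intro j _ hj
    simp [hj]
  · simp

theorem isBoundedOp_pdoSmooth (n : ℕ) (p : ToroidalSymbol) : IsBoundedOp (pdoSmooth n p) := by
  intro k
  obtain ⟨C, k', hC⟩ := exists_multiplier_bound n p
  have hcomm : ∀ (w : List (Fin (n + 1))) (f : Smooth (n + 1)),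
      pderivs w (pdoSmooth n p f) = pdoSmooth n p (pderivs w f) := by
    intro w f
    induction w with
    | nil => rfl
    | cons i w ih =>
      change pderiv i (pderivs w (pdoSmooth n p f)) = pdoSmooth n p (pderiv i (pderivs w f))
      rw [ih, pderiv_pdoSmooth]
  have happ : ∀ (v w : List (Fin (n + 1))) (f : Smooth (n + 1)),
      pderivs (v ++ w) f = pderivs v (pderivs w f) := by
    intro v w f
    induction v with
    | nil => rfl
    | cons i v ih =>
      change pderiv i (pderivs (v ++ w) f) = pderiv i (pderivs v (pderivs w f))
      rw [ih]
  refine ⟨C * ∑' ξ : ℤ, ((1 + |(ξ : ℝ)|) ^ 2)⁻¹, k' + k, fun φ M h w hw z => ?_⟩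
  have h1 : BoundedUpTo k' M (pderivs w φ) := by
    intro v hv y
    rw [← happ]
    exact h _ (by rw [List.length_append]; omega) y
  rw [hcomm]
  change ‖multiplier p (pderivs w φ) z‖ ≤ _
  rw [multiplier_eq, mul_right_comm, ← tsum_mul_left]
  exact tsum_of_norm_bounded (summable_weight.mul_left (C * M)).hasSum
    fun ξ => hC _ M h1 ξ z

/-- `P(D_x)` on `𝒟'(𝕋^n × 𝕋^1)`: the extension by duality, `⟨P u, φ⟩ = ⟨u, ᵗP φ⟩`, where `ᵗP` has
the symbol `p(-ξ)`; equivalently `P(D_x) u = ∑_ξ e^{ixξ} p(ξ) û(t, ξ)`. -/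
def pdo (n : ℕ) (p : ToroidalSymbol) : Distribution (n + 1) →ₗ[ℂ] Distribution (n + 1) :=
  transpose (pdoSmooth n p.reflect) (isBoundedOp_pdoSmooth n p.reflect)

/-! ### The complex -/

/-- `p`-forms `∑_{|K| = p} u_K dt_K` in `dt_1, …, dt_n` with coefficients in `V`; the increasing
multi-index `K` is given as the set of its entries. -/
abbrev Form (n p : ℕ) (V : Type) : Type := {K : Finset (Fin n) // K.card = p} → V

/-- The operator `∑_K u_K dt_K ↦ ∑_j ∑_K (A_j u_K) dt_j ∧ dt_K`. The coefficient of `dt_J` collects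
the pairs `j ∈ J`, `K = J \ {j}`, with `dt_j ∧ dt_K = (-1)^{#{k ∈ J : k < j}} dt_J`. -/
def wedgeMap {n : ℕ} {V : Type} [AddCommGroup V] [Module ℂ V] (A : Fin n → V →ₗ[ℂ] V) {p : ℕ}
    (u : Form n p V) : Form n (p + 1) V :=
  fun J => ∑ j : {j : Fin n // j ∈ J.1}, ((-1 : ℂ) ^ (J.1.filter (fun k => k < j.1)).card) •
    A j.1 (u ⟨J.1.erase j.1, by rw [Finset.card_erase_of_mem j.2, J.2, Nat.add_sub_cancel]⟩)

/-- `𝕃^p = d_t + ∑_j i P_j(D_x) dt_j ∧` on `p`-currents, that is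
`𝕃^p u = ∑_j ∑_K (i L_j u_K) dt_j ∧ dt_K` with `L_j = -i ∂_{t_j} + P_j(D_x)`. -/
def opL {n : ℕ} (P : Fin n → ToroidalSymbol) (p : ℕ) (u : Form n p (Distribution (n + 1))) :
    Form n (p + 1) (Distribution (n + 1)) :=
  wedgeMap (fun j => Complex.I •
    ((-Complex.I) • distDeriv j.castSucc + pdo n (P j))) u

/-- The constant `1`-form `∑_j c_j dt_j` on `𝕋^n` is integral: `(2π)⁻¹ ∫_σ c ∈ ℤ` for every closed
curve `σ` in `𝕋^n` (given by a lift to `ℝ^n`). -/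
def IsIntegralForm {n : ℕ} (c : Fin n → ℂ) : Prop :=
  ∀ σ : ℝ → Fin n → ℝ, ContDiff ℝ 1 σ → (∀ j, ∃ k : ℤ, σ 1 j - σ 0 j = 2 * π * k) →
    ∃ m : ℤ, (2 * π : ℂ)⁻¹ * ∫ s in (0 : ℝ)..1, ∑ j, c j * ((deriv σ s j : ℝ) : ℂ) = m

/-- A `(p+1)`-form on `𝕋^n` (given by its coefficients) is exact: it is `dv` for a smooth
`p`-form `v` on `𝕋^n`. -/
def IsExact {n p : ℕ} (g : Form n (p + 1) ((Fin n → ℝ) → ℂ)) : Prop :=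
  ∃ v : Form n p (Smooth n), ∀ J t, (wedgeMap pderiv v J).1 t = g J t

/-- The set `𝔼^p` of compatible right-hand sides: smooth `(p+1)`-forms `f` such that
`𝕃^{p+1} f = 0` and such that `f̂(t, ξ) e^{iψ_ξ(t)}`, `ψ_ξ(t) = ∑_j p_j(ξ) t_j`, is exact for
every `ξ` for which `∑_j p_j(ξ) dt_j` is integral. -/
def Compatible {n : ℕ} (P : Fin n → ToroidalSymbol) (p : ℕ)
    (f : Form n (p + 1) (Smooth (n + 1))) : Prop :=
  opL P (p + 1) (fun J => ofSmooth (f J)) = 0 ∧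
  ∀ ξ : ℤ, IsIntegralForm (fun j => (P j).val ξ) →
    IsExact fun J t => partialFourier (f J) ξ t *
      Complex.exp (Complex.I * ∑ j, (P j).val ξ * (t j : ℂ))

/-- `𝕃^p` is globally solvable on `𝕋^n × 𝕋^1`: for each `f ∈ 𝔼^p` there is a `p`-current `u` with
`𝕃^p u = f`. -/
def GloballySolvable {n : ℕ} (P : Fin n → ToroidalSymbol) (p : ℕ) : Prop :=
  ∀ f : Form n (p + 1) (Smooth (n + 1)), Compatible P p f →
    ∃ u : Form n p (Distribution (n + 1)), opL P p u = fun J => ofSmooth (f J)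

/-- `α ∈ ℚ^n`. -/
def IsRationalVector {n : ℕ} (α : Fin n → ℝ) : Prop := ∀ j, ∃ r : ℚ, α j = r

/-- The simultaneous Diophantine approximation condition `(SDA)_μ` for `α ∈ ℝ^n \ ℚ^n`: there are
`C > 0` and `(a_ℓ, q_ℓ) ∈ ℤ^n × ℕ`, `q_ℓ ≥ 2`, with
`0 < max_j |α_j^μ - a_{jℓ}^μ / q_ℓ| < C q_ℓ^{-ℓ}` for all `ℓ`. -/
def SDA {n : ℕ} (μ : ℕ) (α : Fin n → ℝ) : Prop :=
  ¬ IsRationalVector α ∧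
  ∃ C : ℝ, 0 < C ∧ ∃ (a : ℕ → Fin n → ℤ) (q : ℕ → ℕ), ∀ l : ℕ, 2 ≤ q l ∧
    (∃ j, 0 < |α j ^ μ - (a l j : ℝ) ^ μ / (q l : ℝ)|) ∧
    ∀ j, |α j ^ μ - (a l j : ℝ) ^ μ / (q l : ℝ)| < C * ((q l : ℝ) ^ l)⁻¹

end TorusComplex

end

/-!
Everything is diagonal on the exponentials `e_m(t, x) = e^{i(tτ + xξ)}`, `m = (τ, ξ) ∈ ℤ^n × ℤ`: on
Fourier coefficients at `m`, `𝕃^p` is exterior multiplication by `i λ(m)`, where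
`λ_j(m) = τ_j + p_j(ξ)` (`opL_expMode`). Where `λ(m) ≠ 0` the Koszul complex of `λ(m)` is exact, and
contraction solves the equation at the cost of a division by the largest component of `λ(m)`
(`koszul_contract`). Where `λ(m) = 0`, the form `∑_j p_j(ξ) dt_j` is integral and the exactness
condition in `𝔼^p` says that the coefficient of `f` vanishes (`Compatible.ofSmooth_eq_zero`). A
distribution on the torus is determined by its Fourier coefficients, those of smooth functions are
exactly the rapidly decreasing families, and those of distributions grow at most polynomially.

Hence, for `p < n`, global solvability is equivalent to the bound `SmallDivisorBound`: the nonzero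
values of `‖λ(m)‖` are at least a negative power of the size of `m`. It suffices since rapid decay
survives the division. It is necessary since a sequence of frequencies that violates it carries a
smooth compatible form whose preimages would have coefficients of superpolynomial growth
(`smallDivisorBound_of_globallySolvable`); this needs a `p`-form `dt_K` with `λ ∧ dt_K` as large as
`λ`, which exists because `p < n`.

It remains to decide when the bound holds. For a fixed `ξ` it always does, as `τ` runs through the
integers. If some `β_j ≠ 0`, the imaginary part of `λ_j` is at least `|β_j|` for `ξ ≠ 0`. If `β = 0`,
failure of the bound is equivalent to `(SDA)_μ`. A small value `τ_j + α_j |ξ|^{ρ/μ}` gives, after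
taking `μ`-th powers, the approximation of `α_j^μ` with `q = |ξ|^ρ` and `a_j = -τ_j`. Conversely, as
`gcd(ρ, μ) = 1`, there are `r, s` with `r ρ = 1 + s μ`, and approximations with denominator `q` give,
by taking `μ`-th roots, small values at `ξ = q^r`, because `|ξ|^{ρ/μ} = q^{1/μ} q^s`. The same
approximations exclude `α ∈ ℚ^n`.
-/

noncomputable section

namespace TorusComplex

/-! ### The Koszul complex of a covector -/

/-- The sign `(-1)^{#{k ∈ J : k < j}}` with which `dt_j ∧ dt_{J \ {j}}` equals `dt_J`. -/
def koszulSign {n : ℕ} (J : Finset (Fin n)) (j : Fin n) : ℂ :=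
  (-1) ^ (J.filter (fun k => k < j)).card

/-- Exterior multiplication `c ∧ ·` by a constant covector `c`, on forms given by their
coefficients; forms of all degrees are treated at once, as functions on all index sets. -/
def koszul {n : ℕ} (c : Fin n → ℂ) (g : Finset (Fin n) → ℂ) (J : Finset (Fin n)) : ℂ :=
  ∑ j ∈ J, koszulSign J j * (c j * g (J.erase j))

/-- Contraction with the vector dual to `c_i dt_i`. -/
def contract {n : ℕ} (c : Fin n → ℂ) (i : Fin n) (f : Finset (Fin n) → ℂ)
    (K : Finset (Fin n)) : ℂ :=
  if i ∈ K then 0 else koszulSign K i * (f (insert i K) / c i)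

theorem norm_koszulSign {n : ℕ} (J : Finset (Fin n)) (j : Fin n) : ‖koszulSign J j‖ = 1 := by
  simp [koszulSign]

theorem koszulSign_mul_self {n : ℕ} (J : Finset (Fin n)) (j : Fin n) :
    koszulSign J j * koszulSign J j = 1 := by
  rw [koszulSign, ← mul_pow]
  simp

theorem koszulSign_erase_self {n : ℕ} (J : Finset (Fin n)) (j : Fin n) :
    koszulSign (J.erase j) j = koszulSign J j := by
  rw [koszulSign, koszulSign, Finset.filter_erase, Finset.erase_eq_of_notMem (by simp)]

theorem koszulSign_erase_of_lt {n : ℕ} {J : Finset (Fin n)} {j k : Fin n} (h : j < k) :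
    koszulSign (J.erase k) j = koszulSign J j := by
  rw [koszulSign, koszulSign, Finset.filter_erase, Finset.erase_eq_of_notMem (by simp [h.le])]

theorem koszulSign_erase_of_gt {n : ℕ} {J : Finset (Fin n)} {j k : Fin n} (hj : j ∈ J)
    (h : j < k) : koszulSign (J.erase j) k = -koszulSign J k := by
  have hmem : j ∈ J.filter (fun l => l < k) := Finset.mem_filter.mpr ⟨hj, h⟩
  rw [koszulSign, koszulSign, Finset.filter_erase, ← Finset.card_erase_add_one hmem, pow_succ]
  ring

theorem koszulSign_swap {n : ℕ} {J : Finset (Fin n)} {j k : Fin n} (hj : j ∈ J) (hk : k ∈ J)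
    (h : j ≠ k) : koszulSign J j * koszulSign (J.erase j) k =
      -(koszulSign J k * koszulSign (J.erase k) j) := by
  rcases lt_or_gt_of_ne h with h | h
  · rw [koszulSign_erase_of_gt hj h, koszulSign_erase_of_lt h]
    ring
  · rw [koszulSign_erase_of_gt hk h, koszulSign_erase_of_lt h]
    ring

theorem koszul_koszul {n : ℕ} (c : Fin n → ℂ) (g : Finset (Fin n) → ℂ) (J : Finset (Fin n)) :
    koszul c (koszul c g) J = 0 := by
  set F : Fin n → Fin n → ℂ := fun j k => if j = k then 0 else
    koszulSign J j * (c j * (koszulSign (J.erase j) k * (c k * g ((J.erase j).erase k)))) with hF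
  have h1 : koszul c (koszul c g) J = ∑ j ∈ J, ∑ k ∈ J, F j k := by
    refine Finset.sum_congr rfl fun j hj => ?_
    rw [koszul, Finset.mul_sum, Finset.mul_sum, ← Finset.sum_erase_add _ _ hj]
    simp only [hF, if_true, add_zero]
    refine Finset.sum_congr rfl fun k hk => ?_
    rw [if_neg (Finset.ne_of_mem_erase hk).symm]
  have h2 : ∑ j ∈ J, ∑ k ∈ J, F j k = -∑ j ∈ J, ∑ k ∈ J, F j k := by
    conv_lhs => rw [Finset.sum_comm]
    rw [← Finset.sum_neg_distrib]
    refine Finset.sum_congr rfl fun k hk => ?_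
    rw [← Finset.sum_neg_distrib]
    refine Finset.sum_congr rfl fun j hj => ?_
    simp only [hF]
    by_cases h : j = k
    · simp [h]
    · rw [if_neg h, if_neg (Ne.symm h), Finset.erase_right_comm]
      linear_combination (c j * (c k * g ((J.erase k).erase j))) * koszulSign_swap hj hk h
  rw [h1]
  exact self_eq_neg.mp h2

/-- The Koszul complex of a nonzero covector is exact, with contraction as the homotopy. -/
theorem koszul_contract {n : ℕ} {c : Fin n → ℂ} {i : Fin n} (hi : c i ≠ 0)
    (f : Finset (Fin n) → ℂ) (J : Finset (Fin n))
    (h : i ∉ J → koszul c f (insert i J) = 0) : koszul c (contract c i f) J = f J := by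
  by_cases hJ : i ∈ J
  · rw [koszul, Finset.sum_eq_single_of_mem i hJ]
    · rw [contract, if_neg (Finset.notMem_erase i J), Finset.insert_erase hJ, koszulSign_erase_self]
      field_simp
      linear_combination f J * koszulSign_mul_self J i
    · intro j _ hji
      rw [contract, if_pos (Finset.mem_erase.mpr ⟨Ne.symm hji, hJ⟩)]
      ring
  · have h0 := h hJ
    rw [koszul, Finset.sum_insert hJ, Finset.erase_insert hJ] at h0
    have hs : koszulSign (insert i J) i = koszulSign J i := by
      rw [← koszulSign_erase_self, Finset.erase_insert hJ]
    rw [hs] at h0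
    have key : koszul c (contract c i f) J = -(koszulSign J i / c i) *
        ∑ j ∈ J, koszulSign (insert i J) j * (c j * f ((insert i J).erase j)) := by
      rw [koszul, Finset.mul_sum]
      refine Finset.sum_congr rfl fun j hj => ?_
      have hij : i ≠ j := fun e => hJ (e ▸ hj)
      rw [contract, if_neg (fun e => hJ (Finset.mem_of_mem_erase e)),
        Finset.erase_insert_of_ne hij]
      have hsw := koszulSign_swap (J := insert i J) (Finset.mem_insert_self i J)
        (Finset.mem_insert_of_mem hj) hij
      rw [Finset.erase_insert hJ, hs] at hsw
      have h3 : koszulSign ((insert i J).erase j) i = koszulSign (J.erase j) i := by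
        rw [Finset.erase_insert_of_ne hij, ← koszulSign_erase_self,
          Finset.erase_insert (fun e => hJ (Finset.mem_of_mem_erase e))]
      rw [h3] at hsw
      field_simp
      have e1 := koszulSign_mul_self (insert i J) j
      have h4 : koszulSign J j * koszulSign (J.erase j) i =
          -(koszulSign J i * koszulSign (insert i J) j) := by
        have h5 : koszulSign (J.erase j) i =
            -(koszulSign (insert i J) j * (koszulSign J i * koszulSign J j)) := by
          linear_combination koszulSign (insert i J) j * hsw - koszulSign (J.erase j) i * e1
        rw [h5]
        linear_combination (-koszulSign J i * koszulSign (insert i J) j) * koszulSign_mul_self J j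
      linear_combination f (insert i (J.erase j)) * c j * h4
    rw [key]
    have h6 : ∑ j ∈ J, koszulSign (insert i J) j * (c j * f ((insert i J).erase j)) =
        -(koszulSign J i * (c i * f J)) := by linear_combination h0
    rw [h6]
    field_simp
    linear_combination f J * koszulSign_mul_self J i

theorem norm_contract_le {n : ℕ} (c : Fin n → ℂ) (i : Fin n) (f : Finset (Fin n) → ℂ)
    (K : Finset (Fin n)) : ‖contract c i f K‖ ≤ ‖f (insert i K)‖ / ‖c i‖ := by
  rw [contract]
  split_ifs
  · rw [norm_zero]
    positivity
  · rw [norm_mul, norm_koszulSign, one_mul, norm_div]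

theorem norm_koszul_le {n : ℕ} (c : Fin n → ℂ) (g : Finset (Fin n) → ℂ) (J : Finset (Fin n))
    (B : ℝ) (hg : ∀ j ∈ J, ‖g (J.erase j)‖ ≤ B) : ‖koszul c g J‖ ≤ J.card * (‖c‖ * B) := by
  rw [← nsmul_eq_mul]
  refine (norm_sum_le _ _).trans (Finset.sum_le_card_nsmul _ _ _ fun j hj => ?_)
  rw [norm_mul, norm_koszulSign, one_mul, norm_mul]
  exact mul_le_mul (norm_le_pi_norm c j) (hg j hj) (norm_nonneg _) (norm_nonneg _)

/-- `c ∧ dt_K` has the coefficient `± c_i` at `K ∪ {i}`. -/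
theorem norm_koszul_single {n : ℕ} (c : Fin n → ℂ) {K : Finset (Fin n)} {i : Fin n} (hi : i ∉ K)
    (s : ℂ) : ‖koszul c (Pi.single K s) (insert i K)‖ = ‖c i‖ * ‖s‖ := by
  rw [koszul, Finset.sum_insert hi, Finset.erase_insert hi, Finset.sum_eq_zero, add_zero,
    Pi.single_eq_same, norm_mul, norm_mul, norm_koszulSign, one_mul]
  intro j hj
  rw [Pi.single_eq_of_ne, mul_zero, mul_zero]
  intro h
  exact hi (h ▸ Finset.mem_erase.mpr ⟨fun e => hi (e ▸ hj), Finset.mem_insert_self i K⟩)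

/-! ### Small divisors -/

/-- The size `2 + |m_1| + ⋯ + |m_d|` of a frequency. The constant `2` lets a power of the weight
absorb any constant factor. -/
def weight {d : ℕ} (m : Fin d → ℤ) : ℝ := 2 + ∑ i, |(m i : ℝ)|

/-- For the frequency `m = (τ, ξ)`, the covector `λ_j = τ_j + p_j(ξ)`: the operator `𝕃^p` acts on
`e^{i(tτ + xξ)}` as exterior multiplication by `i λ`. -/
def freq {n : ℕ} (P : Fin n → ToroidalSymbol) (m : Fin (n + 1) → ℤ) (j : Fin n) : ℂ :=
  (m j.castSucc : ℂ) + (P j).val (m (Fin.last n))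

/-- The covectors `λ(m)` that do not vanish are bounded below by a negative power of the weight
of `m`. -/
def SmallDivisorBound {n : ℕ} (P : Fin n → ToroidalSymbol) : Prop :=
  ∃ N : ℕ, ∀ m, freq P m ≠ 0 → 1 ≤ weight m ^ N * ‖freq P m‖

theorem two_le_weight {d : ℕ} (m : Fin d → ℤ) : 2 ≤ weight m :=
  le_add_of_nonneg_right (Finset.sum_nonneg fun _ _ => abs_nonneg _)

theorem weight_pos {d : ℕ} (m : Fin d → ℤ) : 0 < weight m := two_pos.trans_le (two_le_weight m)

theorem abs_add_two_le_weight {d : ℕ} (m : Fin d → ℤ) (i : Fin d) : |(m i : ℝ)| + 2 ≤ weight m := by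
  rw [weight, add_comm]
  gcongr
  exact Finset.single_le_sum (f := fun i => |(m i : ℝ)|) (fun _ _ => abs_nonneg _)
    (Finset.mem_univ i)

theorem exists_pos_le_norm_intCast_add (c : ℂ) :
    ∃ δ > 0, ∀ k : ℤ, (k : ℂ) + c ≠ 0 → δ ≤ ‖(k : ℂ) + c‖ := by
  by_cases him : c.im = 0
  · have hc : c = (c.re : ℂ) := Complex.ext rfl (by simp [him])
    have hn : ∀ k : ℤ, (k : ℂ) + c = (((k : ℝ) + c.re : ℝ) : ℂ) := fun k => by
      rw [hc]; push_cast; simp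
    by_cases hr : c.re = round c.re
    · refine ⟨1, one_pos, fun k hk => ?_⟩
      have h2 : (k : ℂ) + c = ((k + round c.re : ℤ) : ℂ) := by
        rw [hn, hr]; push_cast; simp
      rw [h2] at hk ⊢
      rw [Complex.norm_intCast]
      exact_mod_cast Int.one_le_abs (Int.cast_ne_zero.mp hk)
    · refine ⟨|c.re - round c.re|, abs_pos.mpr (sub_ne_zero.mpr hr), fun k _ => ?_⟩
      rw [hn, Complex.norm_real, Real.norm_eq_abs]
      have := round_le c.re (-k)
      push_cast at this
      rwa [sub_neg_eq_add, add_comm] at this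
  · refine ⟨|c.im|, abs_pos.mpr him, fun k _ => ?_⟩
    simpa using Complex.abs_im_le_norm ((k : ℂ) + c)

theorem exists_pos_forall_le {ι : Type*} [Finite ι] (δ : ι → ℝ) (h : ∀ i, 0 < δ i) :
    ∃ ε > 0, ∀ i, ε ≤ δ i := by
  have h1 : ∀ᶠ ε : ℝ in nhdsWithin 0 (Set.Ioi 0), ∀ i, ε ≤ δ i :=
    Filter.eventually_all.mpr fun i =>
      (Filter.Eventually.filter_mono nhdsWithin_le_nhds (Iic_mem_nhds (h i)))
  obtain ⟨ε, h2, h3⟩ := (h1.and self_mem_nhdsWithin).exists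
  exact ⟨ε, h3, h2⟩

/-- With `ξ` fixed there are no small divisors. -/
theorem exists_pos_le_norm_freq {n : ℕ} (P : Fin n → ToroidalSymbol) (ξ : ℤ) :
    ∃ δ > 0, ∀ m, m (Fin.last n) = ξ → freq P m ≠ 0 → δ ≤ ‖freq P m‖ := by
  choose δ hδ h using fun j => exists_pos_le_norm_intCast_add ((P j).val ξ)
  obtain ⟨ε, hε, hle⟩ := exists_pos_forall_le δ hδ
  refine ⟨ε, hε, fun m hm hne => ?_⟩
  obtain ⟨j, hj⟩ := Function.ne_iff.mp hne
  have h1 := h j (m j.castSucc) (by rw [← hm]; exact hj)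
  rw [← hm] at h1
  exact (hle j).trans (h1.trans (norm_le_pi_norm (freq P m) j))

theorem exists_one_le_weight_pow_mul {δ : ℝ} (hδ : 0 < δ) :
    ∃ N : ℕ, ∀ (d : ℕ) (m : Fin d → ℤ) (x : ℝ), δ ≤ x → 1 ≤ weight m ^ N * x := by
  obtain ⟨N, hN⟩ := pow_unbounded_of_one_lt δ⁻¹ (one_lt_two (α := ℝ))
  refine ⟨N, fun d m x hx => ?_⟩
  calc 1 = δ⁻¹ * δ := (inv_mul_cancel₀ hδ.ne').symm
    _ ≤ weight m ^ N * x :=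
      mul_le_mul (hN.le.trans (pow_le_pow_left₀ two_pos.le (two_le_weight m) N)) hx hδ.le
        (pow_nonneg (weight_pos m).le N)

/-- If `β ≠ 0`, the imaginary part of `λ` is bounded below for `ξ ≠ 0`. -/
theorem smallDivisorBound_of_im_ne_zero {n : ℕ} {s : ℝ} (hs : 0 ≤ s) {α β : Fin n → ℝ}
    {P : Fin n → ToroidalSymbol}
    (hP : ∀ (j : Fin n) (ξ : ℤ), ξ ≠ 0 →
      (P j).val ξ = ((α j : ℂ) + Complex.I * (β j : ℂ)) * ((|(ξ : ℝ)| ^ s : ℝ) : ℂ))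
    (hβ : β ≠ 0) : SmallDivisorBound P := by
  obtain ⟨j, hj⟩ := Function.ne_iff.mp hβ
  obtain ⟨δ, hδ, h⟩ := exists_pos_le_norm_freq P 0
  obtain ⟨N, hN⟩ := exists_one_le_weight_pow_mul (lt_min hδ (abs_pos.mpr hj))
  refine ⟨N, fun m hm => hN _ _ _ ?_⟩
  by_cases hξ : m (Fin.last n) = 0
  · exact (min_le_left _ _).trans (h m hξ hm)
  · refine (min_le_right _ _).trans (le_trans ?_ (norm_le_pi_norm (freq P m) j))
    refine le_trans ?_ (Complex.abs_im_le_norm _)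
    have h1 : (1 : ℝ) ≤ |(m (Fin.last n) : ℝ)| := by exact_mod_cast Int.one_le_abs hξ
    have h2 : (freq P m j).im = β j * |(m (Fin.last n) : ℝ)| ^ s := by
      rw [freq, hP j _ hξ, Complex.add_im, Complex.im_mul_ofReal]
      simp
    rw [h2, abs_mul, abs_of_nonneg (a := |(m (Fin.last n) : ℝ)| ^ s) (by positivity)]
    exact le_mul_of_one_le_right (abs_nonneg _) (Real.one_le_rpow h1 hs)

theorem rpow_div_pow {x : ℝ} (hx : 0 ≤ x) (ρ : ℕ) {μ : ℕ} (hμ : 0 < μ) :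
    (x ^ ((ρ : ℝ) / (μ : ℝ))) ^ μ = x ^ ρ := by
  rw [← Real.rpow_natCast, ← Real.rpow_mul hx, div_mul_cancel₀ _ (by positivity),
    Real.rpow_natCast]

/-- Rational numbers with a fixed denominator are not well approximable, so the approximation
property already forces `α ∉ ℚ^n`. -/
theorem not_isRationalVector_of_approx {n μ : ℕ} {α : Fin n → ℝ} {C : ℝ}
    {a : ℕ → Fin n → ℤ} {q : ℕ → ℕ}
    (h : ∀ l : ℕ, 2 ≤ q l ∧ (∃ j, 0 < |α j ^ μ - (a l j : ℝ) ^ μ / (q l : ℝ)|) ∧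
      ∀ j, |α j ^ μ - (a l j : ℝ) ^ μ / (q l : ℝ)| < C * ((q l : ℝ) ^ l)⁻¹) :
    ¬ IsRationalVector α := by
  intro hr
  choose r hr using hr
  -- `D` is a common denominator of `α`.
  obtain ⟨D, hD, b, hb⟩ : ∃ D : ℝ, 0 < D ∧ ∃ b : Fin n → ℤ, ∀ j, D * α j = b j ∧
      ∃ D' : ℤ, D = D' := by
    refine ⟨((∏ j, (r j).den : ℕ) : ℝ), ?_, fun j => (∏ i ∈ Finset.univ.erase j, (r i).den) *
      (r j).num, fun j => ⟨?_, ((∏ j, (r j).den : ℕ) : ℤ), by push_cast; rfl⟩⟩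
    · exact_mod_cast Finset.prod_pos fun j _ => (r j).den_pos
    · rw [hr, ← Finset.prod_erase_mul _ _ (Finset.mem_univ j)]
      have := Rat.mul_den_eq_num (r j)
      have h2 : ((r j : ℚ) : ℝ) * ((r j).den : ℝ) = ((r j).num : ℝ) := by exact_mod_cast this
      push_cast
      rw [← h2]
      ring
  obtain ⟨k, hk⟩ := pow_unbounded_of_one_lt (C * D ^ μ) (one_lt_two (α := ℝ))
  obtain ⟨hq, ⟨j, hj⟩, hlt⟩ := h (k + 1)
  obtain ⟨hbj, D', hD'⟩ := hb j
  set Q : ℝ := (q (k + 1) : ℝ) with hQ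
  have hQ2 : (2 : ℝ) ≤ Q := by rw [hQ]; exact_mod_cast hq
  have hQ0 : 0 < Q := by linarith
  have key : D ^ μ * Q * (α j ^ μ - (a (k + 1) j : ℝ) ^ μ / Q) =
      ((b j ^ μ * (q (k + 1) : ℤ) - D' ^ μ * a (k + 1) j ^ μ : ℤ) : ℝ) := by
    push_cast
    rw [← hbj, ← hD', ← hQ]
    field_simp
    ring
  have hge : 1 ≤ D ^ μ * Q * |α j ^ μ - (a (k + 1) j : ℝ) ^ μ / Q| := by
    have h3 : D ^ μ * Q * |α j ^ μ - (a (k + 1) j : ℝ) ^ μ / Q| =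
        |D ^ μ * Q * (α j ^ μ - (a (k + 1) j : ℝ) ^ μ / Q)| := by
      rw [abs_mul, abs_of_pos (a := D ^ μ * Q) (by positivity)]
    have h4 : D ^ μ * Q * (α j ^ μ - (a (k + 1) j : ℝ) ^ μ / Q) ≠ 0 :=
      mul_ne_zero (by positivity) (abs_pos.mp hj)
    rw [h3]
    rw [key] at h4 ⊢
    exact_mod_cast Int.one_le_abs (Int.cast_ne_zero.mp h4)
  have h5 : D ^ μ * Q * |α j ^ μ - (a (k + 1) j : ℝ) ^ μ / Q| <
      D ^ μ * Q * (C * (Q ^ (k + 1))⁻¹) := by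
    gcongr
    exact hlt j
  have h6 : D ^ μ * Q * (C * (Q ^ (k + 1))⁻¹) = C * D ^ μ * (Q ^ k)⁻¹ := by
    field_simp
    ring
  have h7 : (2 : ℝ) ^ k ≤ Q ^ k := by gcongr
  rw [h6, ← div_eq_mul_inv, lt_div_iff₀ (by positivity)] at h5
  have h8 : Q ^ k ≤ D ^ μ * Q * |α j ^ μ - (a (k + 1) j : ℝ) ^ μ / Q| * Q ^ k :=
    le_mul_of_one_le_left (by positivity) hge
  linarith

/-- If small divisors occur, the frequencies `(τ, ξ)` where they do give the simultaneous
approximations `α_j^μ ≈ (-τ_j)^μ / |ξ|^ρ`. -/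
theorem sda_of_not_smallDivisorBound {n ρ μ : ℕ} (hρ : 0 < ρ) (hμ : 0 < μ) {α : Fin n → ℝ}
    {P : Fin n → ToroidalSymbol}
    (hP : ∀ (j : Fin n) (ξ : ℤ), ξ ≠ 0 →
      (P j).val ξ = (α j : ℂ) * ((|(ξ : ℝ)| ^ ((ρ : ℝ) / (μ : ℝ)) : ℝ) : ℂ))
    (hA : ¬ SmallDivisorBound P) : SDA μ α := by
  choose δ hδ hξ using fun k : Fin 3 => exists_pos_le_norm_freq P ((k : ℤ) - 1)
  obtain ⟨ε, hε, hle⟩ := exists_pos_forall_le δ hδ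
  obtain ⟨N₀, hN₀⟩ := exists_one_le_weight_pow_mul hε
  have main : ∀ l : ℕ, ∃ (a : Fin n → ℤ) (q : ℕ), 2 ≤ q ∧
      (∃ j, 0 < |α j ^ μ - (a j : ℝ) ^ μ / (q : ℝ)|) ∧
      ∀ j, |α j ^ μ - (a j : ℝ) ^ μ / (q : ℝ)| < 1 * ((q : ℝ) ^ l)⁻¹ := by
    intro l
    simp only [SmallDivisorBound] at hA
    push Not at hA
    -- `N₀` excludes `|ξ| ≤ 1`, `2 μ` pays for the passage to `μ`-th powers, and `ρ l` for `q ^ l`.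
    obtain ⟨m, hm, hlt⟩ := hA (N₀ + 2 * μ + ρ * l)
    have hw1 : 1 ≤ weight m := by linarith [two_le_weight m]
    have hw0 := weight_pos m
    have hsub : ∀ k ≤ N₀ + 2 * μ + ρ * l, weight m ^ k * ‖freq P m‖ < 1 := fun k hk =>
      (mul_le_mul_of_nonneg_right (pow_le_pow_right₀ hw1 hk) (norm_nonneg _)).trans_lt hlt
    set ξ := m (Fin.last n) with hξdef
    have hξ2 : 2 ≤ |ξ| := by
      by_contra hcon
      have h1 : -1 ≤ ξ ∧ ξ ≤ 1 := by
        rw [← abs_le]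
        exact Int.lt_add_one_iff.mp (lt_of_not_ge hcon)
      obtain ⟨k, hk⟩ : ∃ k : Fin 3, ξ = ((k : ℕ) : ℤ) - 1 :=
        ⟨⟨(ξ + 1).toNat, by omega⟩, by
          change ξ = ((ξ + 1).toNat : ℤ) - 1
          omega⟩
      have h2 := hξ k m hk hm
      have h3 := hN₀ _ m _ ((hle _).trans h2)
      exact absurd (hsub N₀ (by omega)) (not_lt.mpr h3)
    have hξ0 : ξ ≠ 0 := fun h => by simp [h] at hξ2
    set X : ℝ := |(ξ : ℝ)| ^ ((ρ : ℝ) / (μ : ℝ)) with hX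
    have hXμ : X ^ μ = |(ξ : ℝ)| ^ ρ := rpow_div_pow (abs_nonneg _) ρ hμ
    have hlam : ∀ j, freq P m j = (((m j.castSucc : ℝ) + α j * X : ℝ) : ℂ) := fun j => by
      rw [freq, ← hξdef, hP j ξ hξ0]
      push_cast
      rfl
    have hnorm : ∀ j, |(m j.castSucc : ℝ) + α j * X| ≤ ‖freq P m‖ := fun j => by
      have := norm_le_pi_norm (freq P m) j
      rwa [hlam, Complex.norm_real, Real.norm_eq_abs] at this
    have hlt1 : ‖freq P m‖ < 1 := by simpa using hsub 0 (by omega)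
    have hq : ((ξ.natAbs ^ ρ : ℕ) : ℝ) = |(ξ : ℝ)| ^ ρ := by
      rw [Nat.cast_pow, Nat.cast_natAbs, Int.cast_abs]
    have hξR : (2 : ℝ) ≤ |(ξ : ℝ)| := by exact_mod_cast hξ2
    have hq1 : (1 : ℝ) ≤ |(ξ : ℝ)| ^ ρ := one_le_pow₀ (by linarith)
    have hrw : ∀ j, α j ^ μ - ((-m j.castSucc : ℤ) : ℝ) ^ μ / |(ξ : ℝ)| ^ ρ =
        ((α j * X) ^ μ - (-(m j.castSucc : ℝ)) ^ μ) / |(ξ : ℝ)| ^ ρ := fun j => by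
      rw [mul_pow, hXμ, sub_div, mul_div_cancel_right₀ _ (by positivity)]
      push_cast
      rfl
    refine ⟨fun j => -m j.castSucc, ξ.natAbs ^ ρ, ?_, ?_, fun j => ?_⟩
    · have h2 : 2 ≤ ξ.natAbs := by
        have := Int.abs_eq_natAbs ξ
        omega
      exact h2.trans (Nat.le_self_pow hρ.ne' _)
    · obtain ⟨j, hj⟩ := Function.ne_iff.mp hm
      refine ⟨j, abs_pos.mpr ?_⟩
      rw [hq, hrw]
      refine div_ne_zero (fun h0 => ?_) (by positivity)
      rw [sub_eq_zero] at h0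
      have hne : (m j.castSucc : ℝ) + α j * X ≠ 0 := fun h => hj (by rw [hlam, h]; simp)
      have habs : |α j * X| = |-(m j.castSucc : ℝ)| :=
        (pow_left_inj₀ (abs_nonneg _) (abs_nonneg _) hμ.ne').mp
        (by rw [← abs_pow, ← abs_pow, h0])
      -- For even `μ`, equal `μ`-th powers leave a sign open. The wrong sign gives `λ_j = 2 τ_j`,
      -- which is too large unless it vanishes.
      rcases abs_eq_abs.mp habs with h | h
      · exact hne (by rw [h]; ring)
      · rw [neg_neg] at h
        have h1 := (hnorm j).trans_lt hlt1
        rw [h, ← two_mul, abs_mul, abs_two] at h1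
        have h2 : |m j.castSucc| < 1 := by
          have : |(m j.castSucc : ℝ)| < 1 := by linarith [abs_nonneg (m j.castSucc : ℝ)]
          exact_mod_cast this
        rw [Int.abs_lt_one_iff] at h2
        exact hne (by rw [h, h2]; simp)
    · rw [hq, hrw, abs_div, abs_of_pos (a := |(ξ : ℝ)| ^ ρ) (by positivity), one_mul, ← one_div,
        lt_div_iff₀ (by positivity)]
      have hmw := abs_add_two_le_weight m j.castSucc
      have hξw := abs_add_two_le_weight m (Fin.last n)
      rw [← hξdef] at hξw
      have h1 : |α j * X| ≤ weight m := by
        have h2 : |α j * X| ≤ |(m j.castSucc : ℝ) + α j * X| + |(m j.castSucc : ℝ)| := by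
          have := abs_sub ((m j.castSucc : ℝ) + α j * X) (m j.castSucc : ℝ)
          simpa using this
        linarith [hnorm j]
      have h3 : |-(m j.castSucc : ℝ)| ≤ weight m := by
        rw [abs_neg]; linarith
      have h4 := abs_pow_sub_pow_le (α j * X) (-(m j.castSucc : ℝ)) μ
      rw [sub_neg_eq_add, add_comm (α j * X)] at h4
      have hμw : (μ : ℝ) ≤ weight m ^ μ :=
        (by exact_mod_cast Nat.lt_two_pow_self.le : (μ : ℝ) ≤ 2 ^ μ).trans
          (by gcongr; exact two_le_weight m)
      have h5 : |(α j * X) ^ μ - (-(m j.castSucc : ℝ)) ^ μ| ≤ ‖freq P m‖ * weight m ^ (2 * μ) := by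
        calc _ ≤ _ := h4
          _ ≤ ‖freq P m‖ * weight m ^ μ * weight m ^ (μ - 1) := by
            gcongr
            · exact hnorm j
            · exact max_le h1 h3
          _ ≤ ‖freq P m‖ * weight m ^ μ * weight m ^ μ := by
            gcongr
            omega
          _ = _ := by ring
      calc |(α j * X) ^ μ - (-(m j.castSucc : ℝ)) ^ μ| / |(ξ : ℝ)| ^ ρ * (|(ξ : ℝ)| ^ ρ) ^ l
          ≤ |(α j * X) ^ μ - (-(m j.castSucc : ℝ)) ^ μ| * (weight m ^ ρ) ^ l := by
            gcongr
            · exact div_le_self (abs_nonneg _) hq1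
            · linarith
        _ ≤ ‖freq P m‖ * weight m ^ (2 * μ) * (weight m ^ ρ) ^ l := by gcongr
        _ = weight m ^ (2 * μ + ρ * l) * ‖freq P m‖ := by ring
        _ < 1 := hsub _ (by omega)
  choose a q h using main
  exact ⟨not_isRationalVector_of_approx h, 1, one_pos, a, q, h⟩

theorem abs_sub_pow_le_abs_pow_sub {x y : ℝ} (hx : 0 ≤ x) (hy : 0 ≤ y) {μ : ℕ} (hμ : 0 < μ) :
    |x - y| ^ μ ≤ |x ^ μ - y ^ μ| := by
  wlog h : y ≤ x generalizing x y
  · rw [abs_sub_comm, abs_sub_comm (x ^ μ)]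
    exact this hy hx (le_of_not_ge h)
  have h1 := pow_add_pow_le (sub_nonneg.mpr h) hy hμ.ne'
  rw [sub_add_cancel] at h1
  rw [abs_of_nonneg (sub_nonneg.mpr h)]
  exact le_trans (by linarith) (le_abs_self _)

theorem exists_mul_eq_one_add_mul {ρ μ : ℕ} (hρ : 0 < ρ) (hμ : 0 < μ) (h : Nat.gcd ρ μ = 1) :
    ∃ r s : ℕ, 0 < r ∧ r * ρ = 1 + s * μ := by
  rcases (Nat.succ_le_of_lt hμ).eq_or_lt with h1 | h1
  · exact ⟨1, ρ - 1, one_pos, by rw [← h1]; omega⟩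
  · obtain ⟨r, hr⟩ := Nat.exists_mul_mod_eq_one_of_coprime h h1
    refine ⟨r, ρ * r / μ, Nat.pos_of_ne_zero fun h0 => by simp [h0] at hr, ?_⟩
    have := Nat.mod_add_div (ρ * r) μ
    rw [mul_comm r, mul_comm _ μ]
    omega

theorem le_one_add_pow {x : ℝ} (hx : 0 ≤ x) {μ : ℕ} (hμ : 0 < μ) : x ≤ 1 + x ^ μ := by
  rcases le_total x 1 with h | h
  · exact h.trans (le_add_of_nonneg_right (by positivity))
  · linarith [le_self_pow₀ h hμ.ne']

/-- Simultaneous approximations `a^μ / q` of `α^μ` produce small divisors: if `r ρ = 1 + s μ`, then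
`ξ = q^r` has `|ξ|^{ρ/μ} = q^{1/μ} q^s`, so that `α_j |ξ|^{ρ/μ}` is close to the integer
`± a_j q^s`. -/
theorem not_smallDivisorBound_of_sda {n ρ μ : ℕ} (hρ : 0 < ρ) (hμ : 0 < μ)
    (hgcd : Nat.gcd ρ μ = 1) {α : Fin n → ℝ} {P : Fin n → ToroidalSymbol}
    (hP : ∀ (j : Fin n) (ξ : ℤ), ξ ≠ 0 →
      (P j).val ξ = (α j : ℂ) * ((|(ξ : ℝ)| ^ ((ρ : ℝ) / (μ : ℝ)) : ℝ) : ℂ))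
    (hS : SDA μ α) : ¬ SmallDivisorBound P := by
  rintro ⟨N, hN⟩
  obtain ⟨-, C, hC, a, q, hall⟩ := hS
  obtain ⟨r, s, hr, hrs⟩ := exists_mul_eq_one_add_mul hρ hμ hgcd
  set E : ℝ := 3 + ∑ j, (1 + |α j| ^ μ + C) with hE
  set M : ℕ := (1 + s + r) * (N * μ) + (1 + s * μ) with hM
  have htop := tendsto_pow_atTop_atTop_of_one_lt (one_lt_two (α := ℝ))
  -- `ev1` rules out `α_j ^ μ = -a_j ^ μ / q` with `α_j ≠ 0`, where the sign lost below would matter.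
  -- `ev2` contradicts the bound that the small divisor estimate gives for `q ^ l`.
  have ev1 : ∀ᶠ l : ℕ in Filter.atTop, ∀ j, α j ≠ 0 → C < 2 * |α j| ^ μ * 2 ^ l := by
    refine Filter.eventually_all.mpr fun j => ?_
    by_cases hj : α j = 0
    · simp [hj]
    · have hpos : 0 < 2 * |α j| ^ μ := by positivity
      filter_upwards [htop.eventually_gt_atTop (C / (2 * |α j| ^ μ))] with l hl _
      rwa [div_lt_iff₀' hpos] at hl
  have ev2 : ∀ᶠ l : ℕ in Filter.atTop, C * E ^ (N * μ) * 2 ^ M < 2 ^ l :=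
    htop.eventually_gt_atTop _
  obtain ⟨l, hl1, hl2, hlM⟩ := (ev1.and (ev2.and (Filter.eventually_ge_atTop M))).exists
  obtain ⟨hq, ⟨j₀, hj₀⟩, hlt⟩ := hall l
  set Q : ℝ := (q l : ℝ) with hQ
  have hQ2 : (2 : ℝ) ≤ Q := by rw [hQ]; exact_mod_cast hq
  have hQ1 : (1 : ℝ) ≤ Q := by linarith
  have hQ0 : 0 < Q := by linarith
  have hQl : 1 ≤ Q ^ l := one_le_pow₀ hQ1
  set θ : ℝ := Q ^ (((1 : ℕ) : ℝ) / (μ : ℝ)) with hθ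
  have hθ0 : 0 ≤ θ := by positivity
  have hθμ : θ ^ μ = Q := by rw [hθ, rpow_div_pow hQ0.le 1 hμ, pow_one]
  -- The signs of the `a_j` are replaced by those of the `α_j`, as for even `μ` they carry no
  -- information.
  set ε : Fin n → ℤ := fun j => if 0 ≤ α j then 1 else -1 with hε
  have hεα : ∀ j, (ε j : ℝ) * |α j| = α j := fun j => by
    simp only [hε]
    split_ifs with h
    · simp [abs_of_nonneg h]
    · simp [abs_of_neg (not_le.mp h)]
  have hεabs : ∀ j, |(ε j : ℝ)| = 1 := fun j => by
    simp only [hε]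
    split_ifs <;> simp
  set m : Fin (n + 1) → ℤ := Fin.snoc (α := fun _ => ℤ) (fun j => -(ε j * |a l j| * (q l : ℤ) ^ s))
    ((q l : ℤ) ^ r) with hm
  have hmj : ∀ j : Fin n, m j.castSucc = -(ε j * |a l j| * (q l : ℤ) ^ s) := fun j => by simp [hm]
  have hml : m (Fin.last n) = (q l : ℤ) ^ r := by simp [hm]
  have hX : |(m (Fin.last n) : ℝ)| ^ ((ρ : ℝ) / (μ : ℝ)) = θ * Q ^ s := by
    refine (pow_left_inj₀ (by positivity) (by positivity) hμ.ne').mp ?_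
    rw [rpow_div_pow (abs_nonneg _) ρ hμ, hml, mul_pow, hθμ]
    push_cast
    rw [← hQ, abs_of_nonneg (by positivity), ← pow_mul, hrs]
    ring
  have hlam : ∀ j, freq P m j = (((ε j : ℝ) * ((|α j| * θ - |(a l j : ℝ)|) * Q ^ s) : ℝ) : ℂ) := by
    intro j
    rw [freq, hP j _ (by rw [hml]; exact pow_ne_zero _ (by omega)), hX, hmj]
    have h1 : (α j : ℂ) = ((ε j : ℝ) : ℂ) * ((|α j| : ℝ) : ℂ) := by
      rw [← Complex.ofReal_mul, hεα]
    have h2 : ((|a l j| : ℤ) : ℂ) = ((|(a l j : ℝ)| : ℝ) : ℂ) := by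
      rw [← Int.cast_abs, Complex.ofReal_intCast]
    rw [h1, hQ, Int.cast_neg, Int.cast_mul, Int.cast_mul, h2]
    push_cast
    ring
  have hlamn : ∀ j, ‖freq P m j‖ = |(|α j| * θ - |(a l j : ℝ)|)| * Q ^ s := fun j => by
    rw [hlam, Complex.norm_real, Real.norm_eq_abs, abs_mul, hεabs, one_mul, abs_mul,
      abs_of_nonneg (a := Q ^ s) (by positivity)]
  have hdiff : ∀ j, |α j ^ μ * Q - (a l j : ℝ) ^ μ| < C * Q * (Q ^ l)⁻¹ := fun j => by
    have h1 : α j ^ μ * Q - (a l j : ℝ) ^ μ = Q * (α j ^ μ - (a l j : ℝ) ^ μ / Q) := by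
      field_simp
    rw [h1, abs_mul, abs_of_pos hQ0, mul_comm C, mul_assoc]
    exact mul_lt_mul_of_pos_left (hlt j) hQ0
  have hroot : ∀ j, |(|α j| * θ - |(a l j : ℝ)|)| ^ μ ≤ C * Q * (Q ^ l)⁻¹ := fun j => by
    refine (abs_sub_pow_le_abs_pow_sub (by positivity) (abs_nonneg _) hμ).trans ?_
    refine le_trans ?_ (hdiff j).le
    rw [mul_pow, hθμ]
    have := abs_abs_sub_abs_le_abs_sub (α j ^ μ * Q) ((a l j : ℝ) ^ μ)
    rwa [abs_mul, abs_pow, abs_pow, abs_of_pos hQ0] at this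
  have hne : freq P m ≠ 0 := by
    intro h0
    have h1 := hlamn j₀
    rw [h0, Pi.zero_apply, norm_zero, zero_eq_mul] at h1
    have h2 : |α j₀| * θ = |(a l j₀ : ℝ)| := by
      rcases h1 with h1 | h1
      · exact sub_eq_zero.mp (abs_eq_zero.mp h1)
      · exact absurd h1 (by positivity)
    have h3 : |α j₀ ^ μ * Q| = |(a l j₀ : ℝ) ^ μ| := by
      rw [abs_mul, abs_pow, abs_pow, ← h2, mul_pow, hθμ, abs_of_pos hQ0]
    have h4 : α j₀ ^ μ * Q - (a l j₀ : ℝ) ^ μ ≠ 0 := by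
      have h1 : α j₀ ^ μ * Q - (a l j₀ : ℝ) ^ μ = Q * (α j₀ ^ μ - (a l j₀ : ℝ) ^ μ / Q) := by
        field_simp
      rw [h1]
      exact mul_ne_zero hQ0.ne' (abs_pos.mp hj₀)
    rcases abs_eq_abs.mp h3 with h5 | h5
    · exact h4 (sub_eq_zero.mpr h5)
    · have h6 := hdiff j₀
      have hα : α j₀ ≠ 0 := by
        intro hz
        rw [hz, zero_pow hμ.ne', zero_mul] at h4 h5
        exact h4 (by linarith)
      rw [show (a l j₀ : ℝ) ^ μ = -(α j₀ ^ μ * Q) by linarith, sub_neg_eq_add, ← two_mul, abs_mul,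
        abs_two, abs_mul, abs_of_pos hQ0, abs_pow, ← div_eq_mul_inv, lt_div_iff₀ (by positivity)]
        at h6
      have h7 : 2 * |α j₀| ^ μ * 2 ^ l * Q ≤ C * Q := by
        calc 2 * |α j₀| ^ μ * 2 ^ l * Q ≤ 2 * |α j₀| ^ μ * Q ^ l * Q := by gcongr
          _ = 2 * (|α j₀| ^ μ * Q) * Q ^ l := by ring
          _ ≤ C * Q := h6.le
      exact absurd (hl1 j₀ hα) (not_lt.mpr (le_of_mul_le_mul_right h7 hQ0))
  have haj : ∀ j, |(a l j : ℝ)| ≤ (1 + |α j| ^ μ + C) * Q := fun j => by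
    have h1 : |(a l j : ℝ)| ^ μ ≤ |α j| ^ μ * Q + C * Q := by
      have h2 : C * Q * (Q ^ l)⁻¹ ≤ C * Q :=
        mul_le_of_le_one_right (by positivity) (inv_le_one_of_one_le₀ hQl)
      have h3 := abs_sub_abs_le_abs_sub ((a l j : ℝ) ^ μ) (α j ^ μ * Q)
      rw [abs_sub_comm, abs_mul, abs_pow, abs_pow, abs_of_pos hQ0] at h3
      linarith [hdiff j]
    calc |(a l j : ℝ)| ≤ 1 + |(a l j : ℝ)| ^ μ := le_one_add_pow (abs_nonneg _) hμ
      _ ≤ Q + (|α j| ^ μ * Q + C * Q) := add_le_add hQ1 h1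
      _ = _ := by ring
  have hw : weight m ≤ E * Q ^ (1 + s + r) := by
    have h1 : Q ^ (1 + s) ≤ Q ^ (1 + s + r) := pow_le_pow_right₀ hQ1 (by omega)
    have h2 : Q ^ r ≤ Q ^ (1 + s + r) := pow_le_pow_right₀ hQ1 (by omega)
    have h3 : 1 ≤ Q ^ (1 + s + r) := one_le_pow₀ hQ1
    have h4 : ∀ j : Fin n, |(m j.castSucc : ℝ)| ≤ (1 + |α j| ^ μ + C) * Q ^ (1 + s + r) := by
      intro j
      rw [hmj]
      push_cast
      rw [abs_neg, abs_mul, abs_mul, hεabs, one_mul, abs_abs, ← hQ,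
        abs_of_nonneg (a := Q ^ s) (by positivity)]
      calc |(a l j : ℝ)| * Q ^ s ≤ (1 + |α j| ^ μ + C) * Q * Q ^ s := by
            gcongr
            exact haj j
        _ = (1 + |α j| ^ μ + C) * Q ^ (1 + s) := by ring
        _ ≤ _ := by gcongr
    rw [weight, Fin.sum_univ_castSucc, hE, add_mul, Finset.sum_mul]
    have h5 : |(m (Fin.last n) : ℝ)| = Q ^ r := by
      rw [hml]
      push_cast
      rw [← hQ, abs_of_nonneg (by positivity)]
    have h6 := Finset.sum_le_sum fun j (_ : j ∈ Finset.univ) => h4 j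
    rw [h5]
    linarith
  have hfin := hN m hne
  obtain ⟨j, hj⟩ : ∃ j, 1 ≤ weight m ^ N * ‖freq P m j‖ := by
    by_contra hcon
    push Not at hcon
    have hwp : 0 < weight m ^ N := pow_pos (weight_pos m) N
    have : ‖freq P m‖ < (weight m ^ N)⁻¹ := by
      refine (pi_norm_lt_iff (by positivity)).mpr fun j => ?_
      rw [← one_div, lt_div_iff₀' hwp]
      exact hcon j
    rw [← one_div, lt_div_iff₀' hwp] at this
    linarith
  have hcontra : Q ^ l ≤ C * E ^ (N * μ) * Q ^ M := by
    have h1 : 1 ≤ (weight m ^ N * ‖freq P m j‖) ^ μ := one_le_pow₀ hj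
    have h2 : (weight m ^ N * ‖freq P m j‖) ^ μ ≤
        ((E * Q ^ (1 + s + r)) ^ (N * μ)) * (C * Q * (Q ^ l)⁻¹ * Q ^ (s * μ)) := by
      rw [mul_pow, ← pow_mul, hlamn, mul_pow, ← pow_mul]
      have := hroot j
      have := (weight_pos m).le
      gcongr
    have h3 := h1.trans h2
    have h4 : ((E * Q ^ (1 + s + r)) ^ (N * μ)) * (C * Q * (Q ^ l)⁻¹ * Q ^ (s * μ)) =
        C * E ^ (N * μ) * Q ^ M / Q ^ l := by
      rw [hM, div_eq_mul_inv, mul_pow, ← pow_mul, pow_add Q ((1 + s + r) * (N * μ)), pow_add Q 1,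
        pow_one]
      generalize Q ^ ((1 + s + r) * (N * μ)) = A, Q ^ (s * μ) = B, E ^ (N * μ) = D
      ring
    rwa [h4, one_le_div (by positivity)] at h3
  have hE0 : 0 ≤ E := by positivity
  have h1 : Q ^ (l - M) ≤ C * E ^ (N * μ) := by
    have h2 : Q ^ l = Q ^ (l - M) * Q ^ M := by rw [← pow_add, Nat.sub_add_cancel hlM]
    rw [h2] at hcontra
    exact le_of_mul_le_mul_right hcontra (by positivity)
  have h3 : (2 : ℝ) ^ l ≤ C * E ^ (N * μ) * 2 ^ M := by
    calc (2 : ℝ) ^ l = 2 ^ (l - M) * 2 ^ M := by rw [← pow_add, Nat.sub_add_cancel hlM]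
      _ ≤ Q ^ (l - M) * 2 ^ M := by gcongr
      _ ≤ _ := by gcongr
  linarith

/-! ### Exponentials on the torus -/

/-- The exponential `e_m(z) = e^{i m·z}` as an element of `C^∞(𝕋^d)`. -/
def expMode {d : ℕ} (m : Fin d → ℤ) : Smooth d :=
  ⟨fun z => Complex.exp (Complex.I * ∑ i, (m i : ℂ) * (z i : ℂ)), by
    refine ⟨?_, fun z k => ?_⟩
    · refine (contDiff_const.mul (ContDiff.sum fun i _ => contDiff_const.mul ?_)).cexp
      exact Complex.ofRealCLM.contDiff.comp (contDiff_apply ℝ ℝ i)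
    · rw [Complex.exp_eq_exp_iff_exists_int]
      refine ⟨∑ i, m i * k i, ?_⟩
      push_cast
      simp only [mul_add, Finset.sum_add_distrib, Finset.mul_sum, Finset.sum_mul]
      congr 1
      refine Finset.sum_congr rfl fun i _ => ?_
      ring⟩

theorem expMode_apply {d : ℕ} (m : Fin d → ℤ) (z : Fin d → ℝ) :
    (expMode m).1 z = Complex.exp (Complex.I * ∑ i, (m i : ℂ) * (z i : ℂ)) := rfl

theorem norm_expMode {d : ℕ} (m : Fin d → ℤ) (z : Fin d → ℝ) : ‖(expMode m).1 z‖ = 1 := by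
  have : Complex.I * ∑ i, (m i : ℂ) * (z i : ℂ) = ((∑ i, (m i : ℝ) * z i : ℝ) : ℂ) * Complex.I := by
    push_cast
    ring
  rw [expMode_apply, this, Complex.norm_exp_ofReal_mul_I]

theorem expMode_zero {d : ℕ} (z : Fin d → ℝ) : (expMode 0).1 z = 1 := by
  simp [expMode_apply]

theorem expMode_mul {d : ℕ} (m m' : Fin d → ℤ) (z : Fin d → ℝ) :
    (expMode m).1 z * (expMode m').1 z = (expMode (m + m')).1 z := by
  rw [expMode_apply, expMode_apply, expMode_apply, ← Complex.exp_add, ← mul_add,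
    ← Finset.sum_add_distrib]
  congr 2
  refine Finset.sum_congr rfl fun i _ => ?_
  rw [Pi.add_apply]
  push_cast
  ring

theorem expMode_add_smul {d : ℕ} (m : Fin d → ℤ) (z : Fin d → ℝ) (i : Fin d) (s : ℝ) :
    (expMode m).1 (z + s • Pi.single i (1 : ℝ)) =
      Complex.exp (Complex.I * m i * s) * (expMode m).1 z := by
  rw [expMode_apply, expMode_apply, ← Complex.exp_add]
  congr 1
  have h1 : ∀ j, (m j : ℂ) * (((z + s • Pi.single i (1 : ℝ) : Fin d → ℝ) j : ℝ) : ℂ) =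
      (m j : ℂ) * (z j : ℂ) + if j = i then (m i : ℂ) * s else 0 := by
    intro j
    split_ifs with h
    · subst h
      simp [mul_add]
    · simp [h]
  simp only [h1, Finset.sum_add_distrib, Finset.sum_ite_eq', Finset.mem_univ, if_true]
  ring

theorem pderiv_expMode {d : ℕ} (i : Fin d) (m : Fin d → ℤ) :
    pderiv i (expMode m) = (Complex.I * m i) • expMode m := by
  refine Subtype.ext (funext fun z => ?_)
  change fderiv ℝ (expMode m).1 z (Pi.single i 1) = Complex.I * m i * (expMode m).1 z
  rw [← (smooth_differentiable (expMode m) z).lineDeriv_eq_fderiv, lineDeriv]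
  simp only [expMode_add_smul]
  have h1 : HasDerivAt (fun s : ℝ => Complex.I * m i * (s : ℂ)) (Complex.I * m i) 0 := by
    simpa using (Complex.ofRealCLM.hasDerivAt (x := (0 : ℝ))).const_mul (Complex.I * m i)
  have h2 := (h1.cexp.mul_const ((expMode m).1 z)).deriv
  rw [h2]
  simp

theorem pderivs_expMode {d : ℕ} (w : List (Fin d)) (m : Fin d → ℤ) :
    pderivs w (expMode m) = (w.map fun i => Complex.I * (m i : ℂ)).prod • expMode m := by
  induction w with
  | nil => simp [pderivs]
  | cons i w ih =>
    change pderiv i (pderivs w (expMode m)) = _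
    rw [ih, map_smul, pderiv_expMode, smul_smul, List.map_cons, List.prod_cons, mul_comm]

theorem one_le_weight {d : ℕ} (m : Fin d → ℤ) : 1 ≤ weight m :=
  one_le_two.trans (two_le_weight m)

theorem abs_le_weight {d : ℕ} (m : Fin d → ℤ) (i : Fin d) : |(m i : ℝ)| ≤ weight m := by
  linarith [abs_add_two_le_weight m i]

theorem norm_prod_le_weight_pow {d : ℕ} (w : List (Fin d)) (m : Fin d → ℤ) :
    ‖(w.map fun i => Complex.I * (m i : ℂ)).prod‖ ≤ weight m ^ w.length := by
  induction w with
  | nil => simp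
  | cons i w ih =>
    rw [List.map_cons, List.prod_cons, norm_mul, List.length_cons, pow_succ', norm_mul,
      Complex.norm_I, one_mul, Complex.norm_intCast]
    exact mul_le_mul (abs_le_weight m i) ih (norm_nonneg _) (weight_pos m).le

theorem boundedUpTo_expMode {d : ℕ} (k : ℕ) (m : Fin d → ℤ) :
    BoundedUpTo k (weight m ^ k) (expMode m) := by
  intro w hw z
  rw [pderivs_expMode]
  change ‖_ * (expMode m).1 z‖ ≤ _
  rw [norm_mul, norm_expMode, mul_one]
  exact (norm_prod_le_weight_pow w m).trans (pow_le_pow_right₀ (one_le_weight m) hw)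

/-- The Fourier coefficients of a distribution grow at most polynomially. -/
theorem exists_norm_distribution_expMode_le {d : ℕ} (u : Distribution d) :
    ∃ (C : ℝ) (k : ℕ), ∀ m, ‖u.1 (expMode m)‖ ≤ C * weight m ^ k := by
  obtain ⟨C, k, h⟩ := u.2
  exact ⟨C, k, fun m => h _ _ (boundedUpTo_expMode k m)⟩

/-! ### Integration by parts and decay of Fourier coefficients -/

/-- The product in `C^∞(𝕋^d)`. -/
def mulSmooth {d : ℕ} (f g : Smooth d) : Smooth d :=
  ⟨fun z => f.1 z * g.1 z, f.2.1.mul g.2.1, fun z k =>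
    congrArg₂ (· * ·) (f.2.2 z k) (g.2.2 z k)⟩

theorem pderiv_mulSmooth {d : ℕ} (i : Fin d) (f g : Smooth d) :
    pderiv i (mulSmooth f g) = mulSmooth (pderiv i f) g + mulSmooth f (pderiv i g) := by
  refine Subtype.ext (funext fun z => ?_)
  change fderiv ℝ (fun z => f.1 z * g.1 z) z (Pi.single i 1) =
    fderiv ℝ f.1 z (Pi.single i 1) * g.1 z + f.1 z * fderiv ℝ g.1 z (Pi.single i 1)
  rw [fderiv_fun_mul (smooth_differentiable f z) (smooth_differentiable g z)]
  simp only [add_apply, smul_apply, smul_eq_mul]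
  ring

theorem smooth_integrableOn {d : ℕ} (f : Smooth d) :
    MeasureTheory.IntegrableOn f.1 (Set.Icc (0 : Fin d → ℝ) (fun _ => 2 * π)) :=
  (smooth_continuous f).continuousOn.integrableOn_compact isCompact_Icc

theorem integral_pderiv {d : ℕ} (i : Fin d) (f : Smooth d) :
    ∫ z in Set.Icc (0 : Fin d → ℝ) (fun _ => 2 * π), (pderiv i f).1 z = 0 := by
  cases d with
  | zero => exact i.elim0
  | succ d =>
    have hle : (0 : Fin (d + 1) → ℝ) ≤ fun _ => 2 * π := fun _ => by
      simp only [Pi.zero_apply]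
      positivity
    have h := MeasureTheory.integral_divergence_of_hasFDerivAt_off_countable' (E := ℂ)
      (0 : Fin (d + 1) → ℝ) (fun _ => 2 * π) hle (fun j => if j = i then f.1 else 0)
      (fun j z => if j = i then fderiv ℝ f.1 z else 0) ∅ Set.countable_empty
      (fun j => by
        split_ifs
        · exact (smooth_continuous f).continuousOn
        · exact continuousOn_const)
      (fun z _ j => by
        split_ifs
        · exact (smooth_differentiable f z).hasFDerivAt
        · exact hasFDerivAt_const 0 z)
      (by
        refine (smooth_integrableOn (pderiv i f)).congr_fun (fun z _ => ?_) measurableSet_Icc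
        rw [Finset.sum_eq_single i (fun j _ hj => by simp [hj]) (by simp)]
        simp only [if_true]
        rfl)
    have h1 : ∀ z : Fin (d + 1) → ℝ, ∑ j, (if j = i then fderiv ℝ f.1 z else 0)
        (Pi.single j 1) = (pderiv i f).1 z := fun z => by
      rw [Finset.sum_eq_single i (fun j _ hj => by simp [hj]) (by simp)]
      simp only [if_true]
      rfl
    simp only [h1] at h
    rw [h]
    refine Finset.sum_eq_zero fun j _ => ?_
    split_ifs with hj
    · rw [sub_eq_zero]
      congr 1
      funext x
      rw [← smooth_periodic f (j.insertNth ((0 : Fin (d + 1) → ℝ) j) x) (Pi.single j 1)]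
      refine congrArg f.1 (funext fun l => ?_)
      refine Fin.succAboveCases j ?_ (fun l => ?_) l
      · simp
      · simp
    · simp

theorem ofSmooth_apply {d : ℕ} (f φ : Smooth d) : (ofSmooth f).1 φ =
    ∫ z in Set.Icc (0 : Fin d → ℝ) (fun _ => 2 * π), f.1 z * φ.1 z := rfl

theorem ofSmooth_pderiv {d : ℕ} (i : Fin d) (f φ : Smooth d) :
    (ofSmooth (pderiv i f)).1 φ = -(ofSmooth f).1 (pderiv i φ) := by
  have h := integral_pderiv i (mulSmooth f φ)
  rw [pderiv_mulSmooth] at h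
  change ∫ z in _, ((mulSmooth (pderiv i f) φ).1 z + (mulSmooth f (pderiv i φ)).1 z) = 0 at h
  rw [MeasureTheory.integral_add (smooth_integrableOn _) (smooth_integrableOn _)] at h
  exact eq_neg_of_add_eq_zero_left h

theorem ofSmooth_pderiv_expMode {d : ℕ} (i : Fin d) (f : Smooth d) (m : Fin d → ℤ) :
    (ofSmooth (pderiv i f)).1 (expMode (-m)) =
      Complex.I * m i * (ofSmooth f).1 (expMode (-m)) := by
  rw [ofSmooth_pderiv, pderiv_expMode, map_smul, smul_eq_mul, Pi.neg_apply]
  push_cast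
  ring

/-- Rapidly decreasing families of coefficients. -/
def RapidDecay {d : ℕ} (a : (Fin d → ℤ) → ℂ) : Prop :=
  ∀ k : ℕ, ∃ C : ℝ, ∀ m, ‖a m‖ * weight m ^ k ≤ C

theorem rapidDecay_ofSmooth {d : ℕ} (f : Smooth d) :
    RapidDecay fun m => (ofSmooth f).1 (expMode (-m)) := by
  intro k
  induction k generalizing f with
  | zero =>
    refine ⟨∫ z in Set.Icc (0 : Fin d → ℝ) (fun _ => 2 * π), ‖f.1 z‖, fun m => ?_⟩
    rw [pow_zero, mul_one]
    change ‖(ofSmooth f).1 (expMode (-m))‖ ≤ _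
    rw [ofSmooth_apply]
    refine (MeasureTheory.norm_integral_le_integral_norm _).trans_eq ?_
    simp only [norm_mul, norm_expMode, mul_one]
  | succ k ih =>
    obtain ⟨C, hC⟩ := ih f
    choose D hD using fun i => ih (pderiv i f)
    refine ⟨2 * C + ∑ i, D i, fun m => ?_⟩
    have h1 : ∀ i, ‖(ofSmooth (pderiv i f)).1 (expMode (-m))‖ =
        |(m i : ℝ)| * ‖(ofSmooth f).1 (expMode (-m))‖ := fun i => by
      rw [ofSmooth_pderiv_expMode, norm_mul, norm_mul, Complex.norm_I, one_mul,
        Complex.norm_intCast]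
    calc ‖(ofSmooth f).1 (expMode (-m))‖ * weight m ^ (k + 1)
        = 2 * (‖(ofSmooth f).1 (expMode (-m))‖ * weight m ^ k) +
          ∑ i, ‖(ofSmooth (pderiv i f)).1 (expMode (-m))‖ * weight m ^ k := by
          simp only [h1]
          rw [← Finset.sum_mul, ← Finset.sum_mul, pow_succ]
          nth_rewrite 2 [weight]
          ring
      _ ≤ _ := by
          gcongr with i
          · exact hC m
          · exact hD i m

/-! ### Fourier series -/

theorem summable_pi_prod {d : ℕ} {g : ℤ → ℝ} (hg : ∀ k, 0 ≤ g k) (hs : Summable g) :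
    Summable fun m : Fin d → ℤ => ∏ i, g (m i) := by
  induction d with
  | zero => exact Summable.of_finite
  | succ d ih =>
    have h := hs.mul_of_nonneg ih hg fun m => Finset.prod_nonneg fun i _ => hg _
    rw [← (Fin.consEquiv fun _ : Fin (d + 1) => ℤ).summable_iff]
    refine h.congr fun x => ?_
    simp [Fin.prod_univ_succ, Fin.consEquiv]

theorem summable_inv_weight_pow (d : ℕ) :
    Summable fun m : Fin d → ℤ => (weight m ^ (2 * d))⁻¹ := by
  refine (summable_pi_prod (d := d) (fun k => by positivity)
    summable_weight).of_nonneg_of_le (fun m => by have := weight_pos m; positivity) fun m => ?_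
  rw [Finset.prod_inv_distrib]
  refine inv_anti₀ (Finset.prod_pos fun i _ => by positivity) ?_
  calc ∏ i, (1 + |(m i : ℝ)|) ^ 2 ≤ ∏ _i : Fin d, weight m ^ 2 := by
        refine Finset.prod_le_prod (fun i _ => by positivity) fun i _ => ?_
        gcongr
        linarith [abs_add_two_le_weight m i]
    _ = _ := by
        rw [Finset.prod_const, Finset.card_univ, Fintype.card_fin, ← pow_mul]

theorem RapidDecay.summable {d : ℕ} {a : (Fin d → ℤ) → ℂ} (ha : RapidDecay a) (k : ℕ) :
    Summable fun m => ‖a m‖ * weight m ^ k := by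
  obtain ⟨C, hC⟩ := ha (k + 2 * d)
  refine ((summable_inv_weight_pow d).mul_left C).of_nonneg_of_le
    (fun m => by have := weight_pos m; positivity) fun m => ?_
  have := weight_pos m
  rw [← div_eq_mul_inv, le_div_iff₀ (by positivity), mul_assoc, ← pow_add]
  exact hC m

theorem RapidDecay.summable_norm {d : ℕ} {a : (Fin d → ℤ) → ℂ} (ha : RapidDecay a) :
    Summable fun m => ‖a m‖ := by simpa using ha.summable 0

theorem RapidDecay.of_le {d : ℕ} {a b : (Fin d → ℤ) → ℂ} (hb : RapidDecay b)
    (h : ∀ m, ‖a m‖ ≤ ‖b m‖) : RapidDecay a := fun k => by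
  obtain ⟨C, hC⟩ := hb k
  refine ⟨C, fun m => le_trans ?_ (hC m)⟩
  have := weight_pos m
  gcongr
  exact h m

theorem RapidDecay.const_mul {d : ℕ} {a : (Fin d → ℤ) → ℂ} (ha : RapidDecay a) (c : ℂ) :
    RapidDecay fun m => c * a m := fun k => by
  obtain ⟨C, hC⟩ := ha k
  refine ⟨‖c‖ * C, fun m => ?_⟩
  rw [norm_mul, mul_assoc]
  gcongr
  exact hC m

theorem RapidDecay.coord_mul {d : ℕ} {a : (Fin d → ℤ) → ℂ} (ha : RapidDecay a) (i : Fin d) :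
    RapidDecay fun m => Complex.I * m i * a m := fun k => by
  obtain ⟨C, hC⟩ := ha (k + 1)
  refine ⟨C, fun m => le_trans ?_ (hC m)⟩
  have := weight_pos m
  rw [norm_mul, norm_mul, Complex.norm_I, one_mul, Complex.norm_intCast, pow_succ']
  calc |(m i : ℝ)| * ‖a m‖ * weight m ^ k ≤ weight m * ‖a m‖ * weight m ^ k := by
        gcongr
        exact abs_le_weight m i
    _ = _ := by ring

/-- The function with the Fourier series `∑_m a_m e^{i m·z}`. -/
def expSum {d : ℕ} (a : (Fin d → ℤ) → ℂ) (z : Fin d → ℝ) : ℂ := ∑' m, a m * (expMode m).1 z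

theorem summable_expSum {d : ℕ} {a : (Fin d → ℤ) → ℂ} (ha : RapidDecay a) (z : Fin d → ℝ) :
    Summable fun m => a m * (expMode m).1 z :=
  Summable.of_norm (by simpa only [norm_mul, norm_expMode, mul_one] using ha.summable_norm)

theorem norm_expSum_le {d : ℕ} {a : (Fin d → ℤ) → ℂ} (ha : RapidDecay a) (z : Fin d → ℝ) :
    ‖expSum a z‖ ≤ ∑' m, ‖a m‖ :=
  tsum_of_norm_bounded ha.summable_norm.hasSum fun m => by rw [norm_mul, norm_expMode, mul_one]

theorem hasFDerivAt_expSum {d : ℕ} {a : (Fin d → ℤ) → ℂ} (ha : RapidDecay a) (z : Fin d → ℝ) :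
    HasFDerivAt (expSum a) (∑ i, (ContinuousLinearMap.proj (R := ℝ)
      (φ := fun _ : Fin d => ℝ) i).smulRight (expSum (fun m => Complex.I * m i * a m) z)) z := by
  set T : Fin d → ℂ →L[ℝ] ((Fin d → ℝ) →L[ℝ] ℂ) := fun i =>
    ContinuousLinearMap.smulRightL ℝ (Fin d → ℝ) ℂ
      (ContinuousLinearMap.proj (R := ℝ) (φ := fun _ : Fin d => ℝ) i) with hT
  have h := hasFDerivAt_tsum (𝕜 := ℝ) (f := fun m z => a m * (expMode m).1 z)
    (f' := fun m z => ∑ i, T i (Complex.I * m i * a m * (expMode m).1 z))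
    (u := fun m => ∑ i, ‖T i‖ * ‖Complex.I * m i * a m‖) (x₀ := z)
    (summable_sum fun i _ => ((ha.coord_mul i).summable_norm).mul_left _)
    (fun m y => by
      refine ((smooth_differentiable (expMode m) y).hasFDerivAt.const_mul (a m)).congr_fderiv ?_
      rw [fderiv_eq_sum, Finset.smul_sum]
      refine Finset.sum_congr rfl fun i _ => ?_
      rw [pderiv_expMode]
      ext v
      change a m • (v i • (Complex.I * m i * (expMode m).1 y)) =
        v i • (Complex.I * m i * a m * (expMode m).1 y)
      rw [smul_eq_mul, mul_smul_comm]
      congr 1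
      ring)
    (fun m y => norm_sum_le_of_le _ fun i _ => ((T i).le_opNorm _).trans (by
      rw [norm_mul _ ((expMode m).1 y), norm_expMode, mul_one]))
    (summable_expSum ha z) z
  refine h.congr_fderiv ?_
  rw [Summable.tsum_finsetSum fun i _ => (T i).summable (summable_expSum (ha.coord_mul i) z)]
  refine Finset.sum_congr rfl fun i _ => ?_
  rw [← (T i).map_tsum (summable_expSum (ha.coord_mul i) z)]
  rfl

theorem contDiff_expSum {d : ℕ} (N : ℕ) {a : (Fin d → ℤ) → ℂ} (ha : RapidDecay a) :
    ContDiff ℝ N (expSum a) := by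
  induction N generalizing a with
  | zero =>
    exact contDiff_zero.mpr
      (continuous_iff_continuousAt.mpr fun z => (hasFDerivAt_expSum ha z).continuousAt)
  | succ N ih =>
    rw [Nat.cast_succ, contDiff_succ_iff_fderiv_apply]
    refine ⟨fun z => (hasFDerivAt_expSum ha z).differentiableAt, by simp, fun v => ?_⟩
    have : (fun z => fderiv ℝ (expSum a) z v) =
        fun z => ∑ i, v i • expSum (fun m => Complex.I * m i * a m) z := by
      funext z
      rw [(hasFDerivAt_expSum ha z).fderiv, sum_apply]
      rfl
    rw [this]
    exact ContDiff.sum fun i _ => contDiff_const.smul (f := fun _ => v i) (ih (ha.coord_mul i))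

/-- A rapidly decreasing Fourier series as an element of `C^∞(𝕋^d)`. -/
def fourierSeries {d : ℕ} (a : (Fin d → ℤ) → ℂ) (ha : RapidDecay a) : Smooth d :=
  ⟨expSum a, contDiff_infty.mpr fun N => contDiff_expSum N ha, fun z k => by
    simp only [expSum]
    refine tsum_congr fun m => ?_
    rw [smooth_periodic (expMode m)]⟩

theorem pderiv_fourierSeries {d : ℕ} (i : Fin d) {a : (Fin d → ℤ) → ℂ} (ha : RapidDecay a) :
    pderiv i (fourierSeries a ha) = fourierSeries _ (ha.coord_mul i) := by
  refine Subtype.ext (funext fun z => ?_)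
  change fderiv ℝ (expSum a) z (Pi.single i 1) = expSum _ z
  rw [(hasFDerivAt_expSum ha z).fderiv, sum_apply, Finset.sum_eq_single i]
  · simp
  · intro j _ hj
    simp [hj]
  · simp

theorem boundedUpTo_fourierSeries {d : ℕ} (k : ℕ) {a : (Fin d → ℤ) → ℂ} (ha : RapidDecay a) :
    BoundedUpTo k (∑' m, ‖a m‖ * weight m ^ k) (fourierSeries a ha) := by
  intro w hw z
  have key : ∀ w : List (Fin d), ∃ hb : RapidDecay fun m =>
      (w.map fun i => Complex.I * (m i : ℂ)).prod * a m,
      pderivs w (fourierSeries a ha) = fourierSeries _ hb := by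
    intro w
    induction w with
    | nil =>
      refine ⟨by simpa using ha, Subtype.ext ?_⟩
      simp [pderivs, fourierSeries]
    | cons i w ih =>
      obtain ⟨hb, h⟩ := ih
      have e : (fun m : Fin d → ℤ => Complex.I * m i *
          ((w.map fun i => Complex.I * (m i : ℂ)).prod * a m)) =
          fun m => ((i :: w).map fun i => Complex.I * (m i : ℂ)).prod * a m := by
        funext m
        rw [List.map_cons, List.prod_cons]
        ring
      refine ⟨e ▸ hb.coord_mul i, ?_⟩
      change pderiv i (pderivs w _) = _
      rw [h, pderiv_fourierSeries]
      congr 1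
  obtain ⟨hb, h⟩ := key w
  rw [h]
  refine (norm_expSum_le hb z).trans (hb.summable_norm.tsum_le_tsum (fun m => ?_) (ha.summable k))
  rw [norm_mul, mul_comm]
  gcongr
  exact (norm_prod_le_weight_pow w m).trans (pow_le_pow_right₀ (one_le_weight m) hw)

theorem hasSum_distribution_fourierSeries {d : ℕ} (u : Distribution d) {a : (Fin d → ℤ) → ℂ}
    (ha : RapidDecay a) : HasSum (fun m => a m * u.1 (expMode m)) (u.1 (fourierSeries a ha)) := by
  classical
  obtain ⟨C, k, hu⟩ := u.2
  -- The remainder is itself a rapidly decreasing series, so continuity of `u` applies to it.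
  have htail : ∀ s : Finset (Fin d → ℤ),
      ‖∑ m ∈ s, a m * u.1 (expMode m) - u.1 (fourierSeries a ha)‖ ≤
        C * ∑' m : {m // m ∉ s}, ‖a m‖ * weight m.1 ^ k := by
    intro s
    have hb : RapidDecay fun m => if m ∈ s then 0 else a m :=
      ha.of_le fun m => by split_ifs <;> simp
    have h1 : fourierSeries a ha =
        (∑ m ∈ s, a m • expMode m) + fourierSeries _ hb := by
      refine Subtype.ext (funext fun z => ?_)
      have h2 : ((∑ m ∈ s, a m • expMode m : Smooth d)).1 z =
          ∑ m ∈ s, a m * (expMode m).1 z := by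
        rw [AddSubmonoidClass.coe_finsetSum, Finset.sum_apply]
        rfl
      change expSum a z = ((∑ m ∈ s, a m • expMode m : Smooth d)).1 z + expSum _ z
      rw [h2, expSum, expSum, ← (summable_expSum ha z).sum_add_tsum_subtype_compl s,
        ← (summable_expSum hb z).sum_add_tsum_subtype_compl s]
      congr 1
      rw [Finset.sum_eq_zero (fun m hm => by simp [hm]), zero_add]
      exact tsum_congr fun m => by rw [if_neg m.2]
    have h3 : u.1 (fourierSeries a ha) =
        ∑ m ∈ s, a m * u.1 (expMode m) + u.1 (fourierSeries _ hb) := by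
      rw [h1, map_add, map_sum]
      simp only [map_smul, smul_eq_mul]
    rw [h3, sub_add_cancel_left, norm_neg]
    refine (hu _ _ (boundedUpTo_fourierSeries k hb)).trans_eq ?_
    congr 1
    rw [← (hb.summable k).sum_add_tsum_subtype_compl s,
      Finset.sum_eq_zero (fun m hm => by simp [hm]), zero_add]
    exact tsum_congr fun m => by rw [if_neg m.2]
  rw [HasSum, SummationFilter.unconditional_filter, tendsto_iff_norm_sub_tendsto_zero]
  refine squeeze_zero (fun _ => norm_nonneg _) htail ?_
  have := (tendsto_tsum_compl_atTop_zero fun m => ‖a m‖ * weight m ^ k).const_mul C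
  rwa [mul_zero] at this

theorem integral_expMode {d : ℕ} (m : Fin d → ℤ) :
    ∫ z in Set.Icc (0 : Fin d → ℝ) (fun _ => 2 * π), (expMode m).1 z =
      if m = 0 then (2 * π : ℂ) ^ d else 0 := by
  split_ifs with h
  · subst h
    simp only [expMode_zero]
    rw [MeasureTheory.setIntegral_const, MeasureTheory.measureReal_def, Real.volume_Icc_pi]
    simp [Real.pi_pos.le]
  · obtain ⟨i, hi⟩ := Function.ne_iff.mp h
    have h1 := integral_pderiv i (expMode m)
    rw [pderiv_expMode] at h1
    change ∫ z in _, Complex.I * m i * (expMode m).1 z = 0 at h1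
    rw [MeasureTheory.integral_const_mul, mul_eq_zero] at h1
    refine h1.resolve_left (mul_ne_zero Complex.I_ne_zero (Int.cast_ne_zero.mpr hi))

theorem ofSmooth_expMode_expMode {d : ℕ} (m k : Fin d → ℤ) :
    (ofSmooth (expMode m)).1 (expMode (-k)) = if m = k then (2 * π : ℂ) ^ d else 0 := by
  rw [ofSmooth_apply]
  simp only [expMode_mul]
  rw [integral_expMode]
  simp only [← sub_eq_add_neg, sub_eq_zero]

theorem ofSmooth_comm {d : ℕ} (f g : Smooth d) : (ofSmooth f).1 g = (ofSmooth g).1 f := by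
  simp only [ofSmooth_apply, mul_comm]

theorem ofSmooth_fourierSeries {d : ℕ} {a : (Fin d → ℤ) → ℂ} (ha : RapidDecay a)
    (k : Fin d → ℤ) :
    (ofSmooth (fourierSeries a ha)).1 (expMode (-k)) = (2 * π : ℂ) ^ d * a k := by
  have h := hasSum_distribution_fourierSeries (ofSmooth (expMode (-k))) ha
  rw [ofSmooth_comm, ← h.tsum_eq, tsum_eq_single k]
  · rw [ofSmooth_comm, ofSmooth_expMode_expMode, if_pos rfl, mul_comm]
  · intro m hm
    rw [ofSmooth_comm, ofSmooth_expMode_expMode, if_neg hm, mul_zero]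

open scoped Pointwise in
/-- Completeness of the exponentials, transferred from Mathlib's torus `(ℝ/ℤ)^d` by
`z = 2π x`. -/
theorem eq_zero_of_ofSmooth_expMode {d : ℕ} (f : Smooth d)
    (hf : ∀ m, (ofSmooth f).1 (expMode m) = 0) : f = 0 := by
  have hquot' : IsOpenQuotientMap (Pi.map fun _ => ((↑) : ℝ → UnitAddCircle) :
      (Fin d → ℝ) → UnitAddTorus (Fin d)) :=
    IsOpenQuotientMap.piMap fun _ => QuotientAddGroup.isOpenQuotientMap_mk
  set q : C(Fin d → ℝ, UnitAddTorus (Fin d)) := ⟨_, hquot'.continuous⟩ with hq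
  have hquot : Topology.IsQuotientMap q := hquot'.isQuotientMap
  set g : C(Fin d → ℝ, ℂ) := ⟨fun x => f.1 ((2 * π) • x),
    (smooth_continuous f).comp (continuous_const_smul _)⟩ with hg
  have hfac : Function.FactorsThrough g q := by
    intro x y hxy
    have h1 : ∀ i, ∃ k : ℤ, x i = y i + k := fun i => by
      have h2 : ((x i : ℝ) : UnitAddCircle) = (y i : ℝ) := congrFun hxy i
      rw [← sub_eq_zero, ← AddCircle.coe_sub, AddCircle.coe_eq_zero_iff] at h2
      obtain ⟨k, hk⟩ := h2
      refine ⟨k, ?_⟩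
      rw [zsmul_one] at hk
      linarith
    choose k hk using h1
    change f.1 ((2 * π) • x) = f.1 ((2 * π) • y)
    rw [← smooth_periodic f ((2 * π) • y) k]
    refine congrArg f.1 (funext fun i => ?_)
    simp only [Pi.smul_apply, smul_eq_mul, hk]
    ring
  set H : C(UnitAddTorus (Fin d), ℂ) := hquot.lift g hfac with hH
  have hHq : ∀ x, H (q x) = f.1 ((2 * π) • x) := fun x =>
    congrArg (fun F : C(Fin d → ℝ, ℂ) => F x) (hquot.lift_comp g hfac)
  have hcoef : ∀ m, UnitAddTorus.mFourierCoeff H m = 0 := by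
    intro m
    rw [UnitAddTorus.mFourierCoeff_eq_integral H m 0]
    have h1 : ∀ x : Fin d → ℝ, UnitAddTorus.mFourier (-m) (fun i => (x i : UnitAddCircle)) •
        H (fun i => (x i : UnitAddCircle)) =
        (mulSmooth f (expMode (-m))).1 ((2 * π) • x) := by
      intro x
      have h2 : H (fun i => (x i : UnitAddCircle)) = f.1 ((2 * π) • x) := hHq x
      rw [h2, smul_eq_mul, mul_comm]
      change _ = f.1 _ * (expMode (-m)).1 _
      congr 1
      change ∏ i, fourier ((-m) i) (x i : UnitAddCircle) = _
      simp only [fourier_coe_apply]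
      rw [← Complex.exp_sum, expMode_apply, Finset.mul_sum]
      congr 1
      refine Finset.sum_congr rfl fun i _ => ?_
      simp only [Pi.smul_apply, smul_eq_mul]
      push_cast
      ring
    simp only [h1]
    rw [MeasureTheory.Measure.setIntegral_comp_smul_of_pos _ _ _ (by positivity : 0 < 2 * π)]
    have hset : (2 * π) • {x : Fin d → ℝ | ∀ i, x i ∈ Set.Ioc ((0 : Fin d → ℝ) i)
        ((0 : Fin d → ℝ) i + 1)} = Set.univ.pi fun i => Set.Ioc ((0 : Fin d → ℝ) i) (2 * π) := by
      ext y
      rw [Set.mem_smul_set_iff_inv_smul_mem₀ (by positivity)]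
      simp only [Set.mem_ofPred_eq, Set.mem_univ_pi, Pi.smul_apply, smul_eq_mul, Set.mem_Ioc,
        Pi.zero_apply, zero_add]
      refine forall_congr' fun i => and_congr ?_ ?_
      · exact mul_pos_iff_of_pos_left (by positivity)
      · rw [inv_mul_le_iff₀ (by positivity), mul_one]
    rw [hset, MeasureTheory.volume_pi,
      MeasureTheory.setIntegral_congr_set MeasureTheory.Measure.univ_pi_Ioc_ae_eq_Icc,
      ← MeasureTheory.volume_pi]
    exact (congrArg _ (hf (-m))).trans (smul_zero _)
  refine Subtype.ext (funext fun z => ?_)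
  have h0 := UnitAddTorus.hasSum_mFourier_series_apply_of_summable (f := H)
    (by rw [funext hcoef]; exact summable_zero) (q ((2 * π)⁻¹ • z))
  simp only [hcoef, zero_smul] at h0
  have h1 := h0.unique hasSum_zero
  rw [hHq, smul_inv_smul₀ (by positivity)] at h1
  exact h1

/-- The Fourier expansion of a smooth function, tested against a distribution. -/
theorem hasSum_distribution {d : ℕ} (u : Distribution d) (f : Smooth d) :
    HasSum (fun m => ((2 * π : ℂ) ^ d)⁻¹ * (ofSmooth f).1 (expMode (-m)) * u.1 (expMode m))
      (u.1 f) := by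
  have hpi : (2 * π : ℂ) ^ d ≠ 0 := by
    have := Real.pi_ne_zero
    exact pow_ne_zero _ (by simp [this])
  have ha := (rapidDecay_ofSmooth f).const_mul ((2 * π : ℂ) ^ d)⁻¹
  have h : f = fourierSeries _ ha := by
    rw [← sub_eq_zero]
    refine eq_zero_of_ofSmooth_expMode _ fun m => ?_
    rw [ofSmooth_comm, map_sub, ofSmooth_comm, ofSmooth_comm (expMode m), sub_eq_zero]
    conv_rhs => rw [← neg_neg m]
    rw [ofSmooth_fourierSeries, mul_inv_cancel_left₀ hpi, neg_neg]
  have := hasSum_distribution_fourierSeries u ha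
  rwa [← h] at this

/-- A distribution is determined by its Fourier coefficients. -/
theorem distribution_ext {d : ℕ} {u v : Distribution d}
    (h : ∀ m, u.1 (expMode (-m)) = v.1 (expMode (-m))) : u = v := by
  refine Subtype.ext (LinearMap.ext fun f => ?_)
  refine (hasSum_distribution u f).unique ?_
  have h1 : ∀ m, u.1 (expMode m) = v.1 (expMode m) := fun m => by
    simpa using h (-m)
  simp only [h1]
  exact hasSum_distribution v f

theorem exists_smooth_of_rapidDecay {d : ℕ} {a : (Fin d → ℤ) → ℂ} (ha : RapidDecay a) :
    ∃ f : Smooth d, ∀ m, (ofSmooth f).1 (expMode (-m)) = a m := by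
  refine ⟨fourierSeries _ (ha.const_mul ((2 * π : ℂ) ^ d)⁻¹), fun m => ?_⟩
  have := Real.pi_ne_zero
  rw [ofSmooth_fourierSeries, mul_inv_cancel_left₀ (pow_ne_zero _ (by simp [this]))]

/-! ### Partial Fourier coefficients and multipliers -/

theorem mode_expMode {n : ℕ} (m : Fin (n + 1) → ℤ) (ξ : ℤ) (z : Fin (n + 1) → ℝ) :
    mode (expMode m) ξ z = if m (Fin.last n) = ξ then (expMode m).1 z else 0 := by
  have h1 : ∀ s : ℝ, Complex.exp (-(Complex.I * s * ξ)) *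
      (expMode m).1 (z + s • Pi.single (Fin.last n) (1 : ℝ)) =
      Complex.exp (Complex.I * (m (Fin.last n) - ξ) * s) * (expMode m).1 z := fun s => by
    rw [expMode_add_smul, ← mul_assoc, ← Complex.exp_add]
    congr 2
    ring
  have hpi : (2 * π : ℂ) ≠ 0 := by simp [Real.pi_ne_zero]
  rw [mode]
  simp only [h1]
  rw [intervalIntegral.integral_mul_const]
  split_ifs with h
  · simp only [h, sub_self, mul_zero, zero_mul, Complex.exp_zero]
    rw [intervalIntegral.integral_const]
    simp only [sub_zero, Complex.real_smul]
    push_cast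
    field_simp
  · have hc : Complex.I * ((m (Fin.last n) : ℂ) - ξ) ≠ 0 :=
      mul_ne_zero Complex.I_ne_zero (sub_ne_zero.mpr (by exact_mod_cast h))
    have he : Complex.exp (Complex.I * ((m (Fin.last n) : ℂ) - ξ) * ((2 * π : ℝ) : ℂ)) = 1 := by
      rw [Complex.exp_eq_one_iff]
      exact ⟨m (Fin.last n) - ξ, by push_cast; ring⟩
    rw [integral_exp_mul_complex hc, he]
    simp

theorem pdoSmooth_expMode {n : ℕ} (p : ToroidalSymbol) (m : Fin (n + 1) → ℤ) :
    pdoSmooth n p (expMode m) = p.val (m (Fin.last n)) • expMode m := by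
  refine Subtype.ext (funext fun z => ?_)
  change multiplier p (expMode m) z = p.val (m (Fin.last n)) * (expMode m).1 z
  rw [multiplier_eq]
  refine (tsum_eq_single (m (Fin.last n)) ?_).trans ?_
  rotate_left
  · rw [mode_expMode, if_pos rfl]
  · intro ξ hξ
    rw [mode_expMode, if_neg hξ.symm, mul_zero]

/-- `u ↦ mode u ξ z` is a distribution: evaluate at `z` the multiplier with symbol the
indicator function of `{ξ}`. A function without Fourier coefficients over `ξ` therefore has a
vanishing partial Fourier coefficient at `ξ`. -/
theorem partialFourier_eq_zero {n : ℕ} (f : Smooth (n + 1)) (ξ : ℤ)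
    (hf : ∀ m : Fin (n + 1) → ℤ, m (Fin.last n) = ξ → (ofSmooth f).1 (expMode (-m)) = 0)
    (t : Fin n → ℝ) : partialFourier f ξ t = 0 := by
  set p : ToroidalSymbol := ⟨fun η => if η = ξ then 1 else 0, 1, 0, fun η => by
    split_ifs <;> simp⟩ with hp
  set z : Fin (n + 1) → ℝ := Fin.snoc (α := fun _ => ℝ) t 0 with hz
  obtain ⟨C, k, hC⟩ := isBoundedOp_pdoSmooth n p 0
  set u : Distribution (n + 1) := ⟨{
    toFun := fun φ => (pdoSmooth n p φ).1 z
    map_add' := fun φ ψ => by rw [map_add]; rfl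
    map_smul' := fun c φ => by rw [map_smul]; rfl }, C, k, fun φ M h =>
      hC φ M h [] (by simp) z⟩ with hu
  have h1 : u.1 f = 0 := by
    rw [← (hasSum_distribution u f).tsum_eq]
    refine (tsum_congr fun m => ?_).trans tsum_zero
    by_cases hm : m (Fin.last n) = ξ
    · rw [hf m hm, mul_zero, zero_mul]
    · have : u.1 (expMode m) = (pdoSmooth n p (expMode m)).1 z := rfl
      rw [this, pdoSmooth_expMode]
      simp [hp, hm]
  have h2 : u.1 f = mode f ξ z := by
    change multiplier p f z = _
    rw [multiplier_eq]
    refine (tsum_eq_single ξ ?_).trans ?_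
    rotate_left
    · simp [hp]
    · intro η hη
      simp [hp, hη]
  rw [h2, ← mode_eq] at h1
  have h3 := (mul_eq_zero.mp h1).resolve_left (Complex.exp_ne_zero _)
  simpa [hz] using h3

/-- The Fourier coefficients on `𝕋^n × 𝕋^1` as integrals over `𝕋^n` of partial ones. -/
theorem ofSmooth_expMode_eq_integral {n : ℕ} (f : Smooth (n + 1)) (m : Fin (n + 1) → ℤ) :
    (ofSmooth f).1 (expMode (-m)) = 2 * π * ∫ t in Set.Icc (0 : Fin n → ℝ) (fun _ => 2 * π),
      partialFourier f (m (Fin.last n)) t *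
        Complex.exp (-(Complex.I * ∑ j, (m j.castSucc : ℂ) * (t j : ℂ))) := by
  have hpi : (2 * π : ℂ) ≠ 0 := by simp [Real.pi_ne_zero]
  set G : (Fin (n + 1) → ℝ) → ℂ := fun z => f.1 z * (expMode (-m)).1 z with hG
  have hGc : Continuous G := (smooth_continuous f).mul (smooth_continuous _)
  set e := MeasurableEquiv.piFinSuccAbove (fun _ : Fin (n + 1) => ℝ) (Fin.last n) with he
  have hsymm : ∀ x t, e.symm (x, t) = Fin.snoc (α := fun _ => ℝ) t x := fun x t => by
    simp [he, MeasurableEquiv.piFinSuccAbove, Fin.insertNthEquiv]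
  have hmp := (MeasureTheory.volume_preserving_piFinSuccAbove (fun _ : Fin (n + 1) => ℝ)
    (Fin.last n)).symm
  have h1 := hmp.setIntegral_preimage_emb e.symm.measurableEmbedding G
    (Set.Icc (0 : Fin (n + 1) → ℝ) (fun _ => 2 * π))
  have hpre : e.symm ⁻¹' (Set.Icc (0 : Fin (n + 1) → ℝ) (fun _ => 2 * π)) =
      Set.Icc (0 : ℝ) (2 * π) ×ˢ Set.Icc (0 : Fin n → ℝ) (fun _ => 2 * π) := by
    ext ⟨x, t⟩
    rw [Set.mem_preimage, hsymm]
    simp only [Set.mem_Icc, Set.mem_prod, Pi.le_def, Fin.forall_fin_succ', Fin.snoc_castSucc,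
      Fin.snoc_last, Pi.zero_apply]
    tauto
  have hcont : Continuous fun p : ℝ × (Fin n → ℝ) => G (Fin.snoc (α := fun _ => ℝ) p.2 p.1) := by
    refine hGc.comp (continuous_pi fun i => ?_)
    refine Fin.lastCases ?_ (fun j => ?_) i
    · simpa using continuous_fst
    · simp only [Fin.snoc_castSucc]
      exact (continuous_apply j).comp continuous_snd
  rw [ofSmooth_apply, ← h1]
  change ∫ p in e.symm ⁻¹' _, G (e.symm p) = _
  rw [hpre]
  have h2 : ∀ p : ℝ × (Fin n → ℝ), G (e.symm p) = G (Fin.snoc (α := fun _ => ℝ) p.2 p.1) :=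
    fun p => by rw [← hsymm]
  simp only [h2]
  have h3 := MeasureTheory.setIntegral_prod (μ := MeasureTheory.volume)
    (ν := MeasureTheory.volume) (s := Set.Icc (0 : Fin n → ℝ) (fun _ => 2 * π))
    (t := Set.Icc (0 : ℝ) (2 * π))
    (fun p : (Fin n → ℝ) × ℝ => G (Fin.snoc (α := fun _ => ℝ) p.1 p.2))
    ((hcont.comp continuous_swap).continuousOn.integrableOn_compact
      (isCompact_Icc.prod isCompact_Icc))
  rw [MeasureTheory.Measure.volume_eq_prod, ← MeasureTheory.setIntegral_prod_swap]
  refine h3.trans ?_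
  rw [← MeasureTheory.integral_const_mul]
  refine MeasureTheory.setIntegral_congr_fun measurableSet_Icc fun t _ => ?_
  simp only [partialFourier]
  rw [MeasureTheory.integral_Icc_eq_integral_Ioc,
    ← intervalIntegral.integral_of_le (by positivity), ← mul_assoc, mul_inv_cancel_left₀ hpi,
    ← intervalIntegral.integral_mul_const]
  refine intervalIntegral.integral_congr fun x _ => ?_
  simp only [hG, expMode_apply, Fin.sum_univ_castSucc, Fin.snoc_castSucc, Fin.snoc_last,
    Pi.neg_apply]
  rw [mul_right_comm, ← Complex.exp_add, mul_comm]
  congr 2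
  push_cast
  simp only [neg_mul, Finset.sum_neg_distrib]
  ring

/-! ### Integral and exact forms -/

/-- The periods of a constant form over the coordinate circles are its coefficients. -/
theorem isIntegralForm_iff {n : ℕ} (c : Fin n → ℂ) :
    IsIntegralForm c ↔ ∀ j, ∃ k : ℤ, c j = k := by
  have hpi : (2 * π : ℂ) ≠ 0 := by simp [Real.pi_ne_zero]
  have key : ∀ σ : ℝ → Fin n → ℝ, ContDiff ℝ 1 σ →
      ∫ s in (0 : ℝ)..1, ∑ j, c j * ((deriv σ s j : ℝ) : ℂ) =
        ∑ j, c j * ((σ 1 j - σ 0 j : ℝ) : ℂ) := by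
    intro σ hσ
    have hd : ∀ s, HasDerivAt σ (deriv σ s) s := fun s =>
      (hσ.differentiable (by simp) s).hasDerivAt
    have hF : ∀ s, HasDerivAt (fun s => ∑ j, c j * ((σ s j : ℝ) : ℂ))
        (∑ j, c j * ((deriv σ s j : ℝ) : ℂ)) s := fun s =>
      HasDerivAt.fun_sum fun j _ => ((hasDerivAt_pi.mp (hd s) j).ofReal_comp).const_mul (c j)
    have hcont : Continuous (deriv σ) := hσ.continuous_deriv le_rfl
    rw [intervalIntegral.integral_eq_sub_of_hasDerivAt (fun s _ => hF s)
      (Continuous.intervalIntegrable (by fun_prop) _ _), ← Finset.sum_sub_distrib]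
    refine Finset.sum_congr rfl fun j _ => ?_
    push_cast
    ring
  constructor
  · intro h j
    obtain ⟨k, hk⟩ := h (fun s => s • Pi.single j (2 * π)) (by fun_prop) fun i =>
      ⟨if i = j then 1 else 0, by
        by_cases hij : i = j
        · subst hij
          simp
        · simp [hij]⟩
    rw [key _ (by fun_prop), Finset.sum_eq_single j] at hk
    · refine ⟨k, ?_⟩
      rw [← hk]
      simp only [one_smul, zero_smul, Pi.single_eq_same, Pi.zero_apply, sub_zero]
      push_cast
      field_simp
    · intro i _ hij
      simp [hij]
    · simp
  · intro h σ hσ hper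
    choose k hk using h
    choose l hl using hper
    refine ⟨∑ j, k j * l j, ?_⟩
    rw [key σ hσ, Finset.mul_sum]
    push_cast
    refine Finset.sum_congr rfl fun j _ => ?_
    have h1 : ((σ 1 j : ℝ) : ℂ) - ((σ 0 j : ℝ) : ℂ) = 2 * π * l j := by
      rw [← Complex.ofReal_sub, hl j]
      push_cast
      rfl
    rw [h1, hk]
    field_simp

theorem integral_eq_ofSmooth {d : ℕ} (g : Smooth d) :
    ∫ z in Set.Icc (0 : Fin d → ℝ) (fun _ => 2 * π), g.1 z = (ofSmooth (expMode 0)).1 g := by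
  simp only [ofSmooth_apply, expMode_zero, one_mul]

theorem integral_wedgeMap_pderiv {n p : ℕ} (v : Form n p (Smooth n))
    (J : {J : Finset (Fin n) // J.card = p + 1}) :
    ∫ t in Set.Icc (0 : Fin n → ℝ) (fun _ => 2 * π), (wedgeMap pderiv v J).1 t = 0 := by
  rw [integral_eq_ofSmooth, wedgeMap, map_sum]
  refine Finset.sum_eq_zero fun j _ => ?_
  rw [map_smul, ← integral_eq_ofSmooth, integral_pderiv, smul_zero]

/-- The exactness condition on the right-hand side makes its Fourier coefficients vanish at
the frequencies `m` with `λ(m) = 0`. -/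
theorem Compatible.ofSmooth_eq_zero {n p : ℕ} {P : Fin n → ToroidalSymbol}
    {f : Form n (p + 1) (Smooth (n + 1))} (hf : Compatible P p f) {m : Fin (n + 1) → ℤ}
    (hm : freq P m = 0) (J : {J : Finset (Fin n) // J.card = p + 1}) :
    (ofSmooth (f J)).1 (expMode (-m)) = 0 := by
  have hval : ∀ j, (P j).val (m (Fin.last n)) = -(m j.castSucc : ℂ) := fun j =>
    eq_neg_of_add_eq_zero_right (congrFun hm j)
  obtain ⟨v, hv⟩ := hf.2 (m (Fin.last n))
    ((isIntegralForm_iff _).mpr fun j => ⟨-m j.castSucc, by rw [hval]; push_cast; rfl⟩)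
  rw [ofSmooth_expMode_eq_integral, ← mul_zero (2 * π : ℂ), ← integral_wedgeMap_pderiv v J]
  congr 1
  refine MeasureTheory.integral_congr_ae (Filter.Eventually.of_forall fun t => ?_)
  simp only [hv J t, hval, neg_mul, Finset.sum_neg_distrib, mul_neg]

/-! ### The complex on Fourier coefficients -/

/-- The Fourier coefficient at `m` of a `p`-current, extended by zero to the index sets with
other than `p` elements. -/
def coeffs {n p : ℕ} (u : Form n p (Distribution (n + 1))) (m : Fin (n + 1) → ℤ)
    (K : Finset (Fin n)) : ℂ :=
  if h : K.card = p then (u ⟨K, h⟩).1 (expMode (-m)) else 0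

theorem coeffs_of_card {n p : ℕ} (u : Form n p (Distribution (n + 1))) (m : Fin (n + 1) → ℤ)
    (K : {K : Finset (Fin n) // K.card = p}) : coeffs u m K.1 = (u K).1 (expMode (-m)) := by
  rw [coeffs, dif_pos K.2]

theorem pdo_expMode {n : ℕ} (P : Fin n → ToroidalSymbol) (j : Fin n)
    (v : Distribution (n + 1)) (m : Fin (n + 1) → ℤ) :
    ((Complex.I • ((-Complex.I) • distDeriv j.castSucc + pdo n (P j))) v).1 (expMode (-m)) =
      Complex.I * freq P m j * v.1 (expMode (-m)) := by
  have h1 : (distDeriv j.castSucc v).1 (expMode (-m)) =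
      Complex.I * m j.castSucc * v.1 (expMode (-m)) := by
    change v.1 (-(pderiv j.castSucc (expMode (-m)))) = _
    rw [pderiv_expMode, map_neg, map_smul, smul_eq_mul, Pi.neg_apply]
    push_cast
    ring
  have h2 : (pdo n (P j) v).1 (expMode (-m)) =
      (P j).val (m (Fin.last n)) * v.1 (expMode (-m)) := by
    change v.1 (pdoSmooth n (P j).reflect (expMode (-m))) = _
    rw [pdoSmooth_expMode, map_smul, smul_eq_mul]
    change (P j).val (- -m (Fin.last n)) * _ = _
    rw [neg_neg]
  change Complex.I * (-Complex.I * (distDeriv j.castSucc v).1 (expMode (-m)) +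
    (pdo n (P j) v).1 (expMode (-m))) = _
  rw [h1, h2, freq]
  linear_combination (-Complex.I * m j.castSucc * v.1 (expMode (-m))) * Complex.I_sq

theorem koszul_congr {n : ℕ} (c : Fin n → ℂ) {g h : Finset (Fin n) → ℂ} {J : Finset (Fin n)}
    (hgh : ∀ j ∈ J, g (J.erase j) = h (J.erase j)) : koszul c g J = koszul c h J :=
  Finset.sum_congr rfl fun j hj => by rw [hgh j hj]

/-- On the Fourier coefficients at `m`, the operator `𝕃^p` is exterior multiplication by
`i λ(m)`. -/
theorem opL_expMode {n p : ℕ} (P : Fin n → ToroidalSymbol)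
    (u : Form n p (Distribution (n + 1))) (m : Fin (n + 1) → ℤ)
    (J : {J : Finset (Fin n) // J.card = p + 1}) :
    (opL P p u J).1 (expMode (-m)) = koszul (Complex.I • freq P m) (coeffs u m) J.1 := by
  rw [opL, wedgeMap, koszul, AddSubmonoidClass.coe_finsetSum, LinearMap.sum_apply,
    ← Finset.sum_coe_sort J.1 fun j => koszulSign J.1 j *
      ((Complex.I • freq P m) j * coeffs u m (J.1.erase j))]
  refine Finset.sum_congr rfl fun j _ => ?_
  have hc : (J.1.erase j.1).card = p := by
    rw [Finset.card_erase_of_mem j.2, J.2, Nat.add_sub_cancel]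
  rw [coeffs_of_card u m ⟨J.1.erase j.1, hc⟩]
  change koszulSign J.1 j.1 * (((Complex.I • ((-Complex.I) • distDeriv j.1.castSucc +
    pdo n (P j.1))) (u ⟨J.1.erase j.1, hc⟩)).1 (expMode (-m))) = _
  rw [pdo_expMode]
  rfl

theorem exists_norm_apply_eq_norm {n : ℕ} (hn : 0 < n) (c : Fin n → ℂ) : ∃ i, ‖c i‖ = ‖c‖ := by
  have : Nonempty (Fin n) := ⟨⟨0, hn⟩⟩
  obtain ⟨i, hi⟩ := Finite.exists_max fun i => ‖c i‖
  exact ⟨i, le_antisymm (norm_le_pi_norm c i) ((pi_norm_le_iff_of_nonneg (norm_nonneg _)).mpr hi)⟩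

theorem RapidDecay.of_le_weight_pow_mul {d : ℕ} {ι : Type*} [Fintype ι] {a : (Fin d → ℤ) → ℂ}
    {b : ι → (Fin d → ℤ) → ℂ} (hb : ∀ i, RapidDecay (b i)) (N : ℕ)
    (h : ∀ m, ‖a m‖ ≤ weight m ^ N * ∑ i, ‖b i m‖) : RapidDecay a := fun k => by
  choose C hC using fun i => hb i (N + k)
  refine ⟨∑ i, C i, fun m => ?_⟩
  have := weight_pos m
  calc ‖a m‖ * weight m ^ k ≤ weight m ^ N * (∑ i, ‖b i m‖) * weight m ^ k := by
        gcongr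
        exact h m
    _ = ∑ i, ‖b i m‖ * weight m ^ (N + k) := by
        rw [← Finset.sum_mul, pow_add]
        ring
    _ ≤ _ := Finset.sum_le_sum fun i _ => hC i m

/-! ### Solvability and small divisors -/

/-- Dividing by the largest component of `λ(m)` solves the equation frequency by frequency; the
solution is even smooth. -/
theorem globallySolvable_of_smallDivisorBound {n p : ℕ} (hn : 0 < n) {P : Fin n → ToroidalSymbol}
    (hP : SmallDivisorBound P) : GloballySolvable P p := by
  classical
  intro f hf
  obtain ⟨N, hN⟩ := hP
  choose i hi using fun m => exists_norm_apply_eq_norm hn (freq P m)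
  set F : (Fin (n + 1) → ℤ) → Finset (Fin n) → ℂ := coeffs fun J => ofSmooth (f J) with hF
  have hFdecay : ∀ J, RapidDecay fun m => F m J := fun J => by
    by_cases hJ : J.card = p + 1
    · simpa only [hF, coeffs, hJ, dif_pos] using rapidDecay_ofSmooth (f ⟨J, hJ⟩)
    · refine fun k => ⟨0, fun m => ?_⟩
      simp [hF, coeffs, hJ]
  have hFclosed : ∀ m (J : Finset (Fin n)), J.card = p + 1 + 1 →
      koszul (Complex.I • freq P m) (F m) J = 0 := fun m J hJ => by
    have h := opL_expMode P (fun J => ofSmooth (f J)) m ⟨J, hJ⟩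
    rw [hf.1] at h
    exact h.symm
  set G : (Fin (n + 1) → ℤ) → Finset (Fin n) → ℂ := fun m K =>
    if freq P m = 0 then 0 else contract (Complex.I • freq P m) (i m) (F m) K with hG
  have hGdecay : ∀ K, RapidDecay fun m => G m K := fun K => by
    refine RapidDecay.of_le_weight_pow_mul hFdecay N fun m => ?_
    have hw := weight_pos m
    have hsum : ∀ J, ‖F m J‖ ≤ ∑ J, ‖F m J‖ := fun J =>
      Finset.single_le_sum (f := fun J => ‖F m J‖) (fun _ _ => norm_nonneg _) (Finset.mem_univ J)
    simp only [hG]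
    split_ifs with h0
    · rw [norm_zero]
      positivity
    · refine (norm_contract_le _ _ _ _).trans ?_
      have hpos : 0 < ‖freq P m‖ := norm_pos_iff.mpr h0
      rw [Pi.smul_apply, norm_smul, Complex.norm_I, one_mul, hi, div_le_iff₀ hpos, mul_right_comm]
      exact (hsum _).trans (le_mul_of_one_le_left ((norm_nonneg _).trans (hsum ∅)) (hN m h0))
  choose u hu using fun K => exists_smooth_of_rapidDecay (hGdecay K)
  refine ⟨fun K => ofSmooth (u K.1), funext fun J => distribution_ext fun m => ?_⟩
  rw [opL_expMode]
  have hcoef : koszul (Complex.I • freq P m) (coeffs (p := p) (fun K => ofSmooth (u K.1)) m) J.1 =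
      koszul (Complex.I • freq P m) (G m) J.1 := by
    refine koszul_congr _ fun j hj => ?_
    have hc : (J.1.erase j).card = p := by
      rw [Finset.card_erase_of_mem hj, J.2, Nat.add_sub_cancel]
    rw [coeffs_of_card _ m ⟨_, hc⟩]
    exact hu _ m
  rw [hcoef]
  by_cases h0 : freq P m = 0
  · rw [hf.ofSmooth_eq_zero h0 J, h0]
    simp [koszul]
  · have hGm : G m = contract (Complex.I • freq P m) (i m) (F m) :=
      funext fun K => by simp only [hG, h0, if_false]
    rw [hGm, koszul_contract]
    · exact coeffs_of_card _ m J
    · rw [Pi.smul_apply, smul_eq_mul]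
      refine mul_ne_zero Complex.I_ne_zero ?_
      rw [← norm_pos_iff, hi]
      exact norm_pos_iff.mpr h0
    · intro hJ
      refine hFclosed m _ ?_
      rw [Finset.card_insert_of_notMem hJ, J.2]

/-- If small divisors occur, at frequencies `m_N` say, the form with coefficients
`‖λ‖^{-1/2} i λ ∧ dt_K` at these frequencies is smooth, since the coefficients have the size
`‖λ‖^{1/2}`, and any solution would have coefficients of size `‖λ‖^{-1/2}` there. It is compatible
because `‖λ(m_N)‖ < 1` keeps the form `∑_j p_j(ξ) dt_j` from being integral. -/
theorem smallDivisorBound_of_globallySolvable {n p : ℕ} (hp : p < n) {P : Fin n → ToroidalSymbol}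
    (hS : GloballySolvable P p) : SmallDivisorBound P := by
  classical
  by_contra hA
  simp only [SmallDivisorBound] at hA
  push Not at hA
  choose M hM0 hMlt using hA
  have hlt1 : ∀ N, ‖freq P (M N)‖ < 1 := fun N =>
    (le_mul_of_one_le_left (norm_nonneg _) (one_le_pow₀ (one_le_weight _))).trans_lt (hMlt N)
  have hsqrt : ∀ N k, 2 * k ≤ N → weight (M N) ^ k * √‖freq P (M N)‖ ≤ 1 := fun N k hk => by
    have hw := weight_pos (M N)
    rw [← abs_of_nonneg (a := weight (M N) ^ k * √‖freq P (M N)‖) (by positivity),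
      ← sq_le_one_iff_abs_le_one, mul_pow, Real.sq_sqrt (norm_nonneg _), ← pow_mul, mul_comm k]
    refine le_trans ?_ (hMlt N).le
    gcongr
    exact one_le_weight _
  choose i hi using fun m => exists_norm_apply_eq_norm (by omega : 0 < n) (freq P m)
  have hK : ∀ m, ∃ K : Finset (Fin n), i m ∉ K ∧ K.card = p := fun m => by
    obtain ⟨K, hK, hc⟩ := Finset.exists_subset_card_eq (s := Finset.univ.erase (i m)) (n := p)
      (by rw [Finset.card_erase_of_mem (Finset.mem_univ _), Finset.card_univ, Fintype.card_fin]
          omega)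
    exact ⟨K, fun h => Finset.notMem_erase _ _ (hK h), hc⟩
  choose K hiK hKc using hK
  have hnormI : ∀ m, ‖Complex.I • freq P m‖ = ‖freq P m‖ := fun m => by
    rw [norm_smul, Complex.norm_I, one_mul]
  set A : (Fin (n + 1) → ℤ) → Finset (Fin n) → ℂ := fun m =>
    if m ∈ Set.range M then koszul (Complex.I • freq P m)
      (Pi.single (K m) (((√‖freq P m‖)⁻¹ : ℝ) : ℂ)) else 0 with hAdef
  have hAM : ∀ N, A (M N) = koszul (Complex.I • freq P (M N))
      (Pi.single (K (M N)) (((√‖freq P (M N)‖)⁻¹ : ℝ) : ℂ)) := fun N => by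
    simp only [hAdef, Set.mem_range_self, if_true]
  have hAnorm : ∀ N J, ‖A (M N) J‖ ≤ n * √‖freq P (M N)‖ := fun N J => by
    rw [hAM]
    refine (norm_koszul_le _ _ J (√‖freq P (M N)‖)⁻¹ fun j _ => ?_).trans ?_
    · rw [Pi.single_apply]
      split_ifs
      · rw [Complex.norm_real, Real.norm_of_nonneg (by positivity)]
      · rw [norm_zero]
        positivity
    · rw [hnormI, ← div_eq_mul_inv, Real.div_sqrt]
      gcongr
      simpa using J.card_le_univ
  have hAdecay : ∀ J, RapidDecay fun m => A m J := fun J k => by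
    refine ⟨n + ∑ N ∈ Finset.range (2 * k), ‖A (M N) J‖ * weight (M N) ^ k, fun m => ?_⟩
    have hnn : ∀ N, 0 ≤ ‖A (M N) J‖ * weight (M N) ^ k := fun N => by
      have := weight_pos (M N)
      positivity
    by_cases hm : m ∈ Set.range M
    · obtain ⟨N, rfl⟩ := hm
      by_cases hN : 2 * k ≤ N
      · refine le_trans ?_ (le_add_of_nonneg_right (Finset.sum_nonneg fun N _ => hnn N))
        have := weight_pos (M N)
        calc ‖A (M N) J‖ * weight (M N) ^ k ≤ n * √‖freq P (M N)‖ * weight (M N) ^ k := by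
              gcongr
              exact hAnorm N J
          _ = n * (weight (M N) ^ k * √‖freq P (M N)‖) := by ring
          _ ≤ n * 1 := by
              gcongr
              exact hsqrt N k hN
          _ = n := mul_one _
      · refine le_trans ?_ (le_add_of_nonneg_left (Nat.cast_nonneg n))
        exact Finset.single_le_sum (f := fun N => ‖A (M N) J‖ * weight (M N) ^ k)
          (fun N _ => hnn N) (Finset.mem_range.mpr (not_le.mp hN))
    · have h0 : A m = 0 := by simp only [hAdef, hm, if_false]
      change ‖A m J‖ * weight m ^ k ≤ _
      rw [h0, Pi.zero_apply, norm_zero, zero_mul]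
      exact add_nonneg (Nat.cast_nonneg n) (Finset.sum_nonneg fun N _ => hnn N)
  choose f hf using fun J => exists_smooth_of_rapidDecay (hAdecay J)
  have hcomp : Compatible P p fun J => f J.1 := by
    refine ⟨funext fun J => distribution_ext fun m => ?_, fun ξ hξ => ?_⟩
    · rw [opL_expMode]
      have h1 : koszul (Complex.I • freq P m)
          (coeffs (p := p + 1) (fun J => ofSmooth (f J.1)) m) J.1 =
          koszul (Complex.I • freq P m) (A m) J.1 := by
        refine koszul_congr _ fun j hj => ?_
        have hc : (J.1.erase j).card = p + 1 := by
          rw [Finset.card_erase_of_mem hj, J.2, Nat.add_sub_cancel]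
        rw [coeffs_of_card _ m ⟨_, hc⟩]
        exact hf _ m
      rw [h1]
      change _ = (0 : ℂ)
      simp only [hAdef]
      split_ifs
      · exact koszul_koszul _ _ _
      · simp [koszul]
    · have hzero : ∀ J t, partialFourier (f J) ξ t = 0 := fun J t => by
        refine partialFourier_eq_zero (f J) ξ (fun m hm => ?_) t
        rw [hf]
        by_cases hr : m ∈ Set.range M
        · obtain ⟨N, rfl⟩ := hr
          refine absurd (funext fun j => ?_) (hM0 N)
          obtain ⟨k, hk⟩ := (isIntegralForm_iff _).mp hξ j
          have h1 : freq P (M N) j = ((M N j.castSucc + k : ℤ) : ℂ) := by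
            rw [freq, hm, hk]
            push_cast
            rfl
          have h2 := (norm_le_pi_norm (freq P (M N)) j).trans_lt (hlt1 N)
          rw [h1, Complex.norm_intCast] at h2
          have h3 : |M N j.castSucc + k| < 1 := by exact_mod_cast h2
          rw [h1, Int.abs_lt_one_iff.mp h3]
          simp
        · simp only [hAdef, hr, if_false, Pi.zero_apply]
      refine ⟨0, fun J t => ?_⟩
      have hw : wedgeMap pderiv (0 : Form n p (Smooth n)) J = 0 :=
        Finset.sum_eq_zero fun j _ => by
          rw [Pi.zero_apply, map_zero, smul_zero]
      simp only [hw, hzero, zero_mul]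
      rfl
  obtain ⟨u, hu⟩ := hS _ hcomp
  obtain ⟨C, k, hC⟩ : ∃ (C : ℝ) (k : ℕ), ∀ m J, ‖coeffs u m J‖ ≤ C * weight m ^ k := by
    choose C k hC using fun J => exists_norm_distribution_expMode_le (u J)
    have hC0 : ∀ J, 0 ≤ C J := fun J => by
      have h1 := (norm_nonneg _).trans (hC J 0)
      exact nonneg_of_mul_nonneg_left h1 (pow_pos (weight_pos _) _)
    refine ⟨∑ J, C J, ∑ J, k J, fun m J => ?_⟩
    have hw := one_le_weight m
    rw [coeffs]
    split_ifs with h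
    · have h1 := hC ⟨J, h⟩ (-m)
      have hwneg : weight (-m) = weight m := by simp [weight]
      rw [hwneg] at h1
      refine h1.trans (mul_le_mul ?_ (pow_le_pow_right₀ hw ?_) (by positivity)
        (Finset.sum_nonneg fun J _ => hC0 J))
      · exact Finset.single_le_sum (fun J _ => hC0 J) (Finset.mem_univ _)
      · exact Finset.single_le_sum (fun J _ => Nat.zero_le _) (Finset.mem_univ _)
    · rw [norm_zero]
      exact mul_nonneg (Finset.sum_nonneg fun J _ => hC0 J) (by positivity)
  -- At `m = M (2 (k + l))` the bound `C weight(m) ^ k` is exceeded by a factor `2 ^ l / (n C) > 1`.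
  obtain ⟨l, hl⟩ := pow_unbounded_of_one_lt (n * C) (one_lt_two (α := ℝ))
  set m := M (2 * (k + l)) with hm
  have hAm : A m = koszul (Complex.I • freq P m)
      (Pi.single (K m) (((√‖freq P m‖)⁻¹ : ℝ) : ℂ)) := hAM _
  have hJc : (insert (i m) (K m)).card = p + 1 := by
    rw [Finset.card_insert_of_notMem (hiK m), hKc]
  have hpos : 0 < ‖freq P m‖ := norm_pos_iff.mpr (hM0 _)
  have hw := weight_pos m
  have h1 := opL_expMode P u m ⟨_, hJc⟩
  rw [hu] at h1
  change (ofSmooth (f (insert (i m) (K m)))).1 (expMode (-m)) = _ at h1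
  rw [hf, hAm] at h1
  have h2 := congrArg norm h1
  rw [norm_koszul_single _ (hiK m), Pi.smul_apply, norm_smul, Complex.norm_I, one_mul, hi,
    Complex.norm_real, Real.norm_of_nonneg (by positivity), ← div_eq_mul_inv, Real.div_sqrt] at h2
  have h3 := norm_koszul_le (Complex.I • freq P m) (coeffs u m) (insert (i m) (K m))
    (C * weight m ^ k) fun j _ => hC m _
  rw [← h2, hnormI] at h3
  have hC0 : 0 ≤ C * weight m ^ k := (norm_nonneg _).trans (hC m ∅)
  have h4 : √‖freq P m‖ ≤ n * (‖freq P m‖ * (C * weight m ^ k)) := by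
    refine h3.trans ?_
    gcongr
    simpa using (insert (i m) (K m)).card_le_univ
  have hs : 0 < √‖freq P m‖ := Real.sqrt_pos.mpr hpos
  have h5 : 1 ≤ n * C * (weight m ^ k * √‖freq P m‖) := by
    have h6 : n * (‖freq P m‖ * (C * weight m ^ k)) =
        n * C * (weight m ^ k * √‖freq P m‖) * √‖freq P m‖ := by
      nth_rewrite 1 [← Real.mul_self_sqrt (norm_nonneg (freq P m))]
      ring
    rw [h6] at h4
    exact le_of_mul_le_mul_right (by rwa [one_mul]) hs
  have h7 := hsqrt (2 * (k + l)) (k + l) le_rfl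
  rw [← hm, pow_add] at h7
  have h8 : (2 : ℝ) ^ l ≤ weight m ^ l := by
    gcongr
    exact two_le_weight m
  have hCnn : 0 ≤ C := nonneg_of_mul_nonneg_left hC0 (by positivity)
  have h9 : weight m ^ l ≤ n * C := by
    calc weight m ^ l = weight m ^ l * 1 := (mul_one _).symm
      _ ≤ weight m ^ l * (n * C * (weight m ^ k * √‖freq P m‖)) := by gcongr
      _ = n * C * (weight m ^ k * weight m ^ l * √‖freq P m‖) := by ring
      _ ≤ n * C * 1 := by gcongr
      _ = n * C := mul_one _
  linarith

end TorusComplex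

end

theorem mainTheorem2 (n p ρ μ : ℕ) (hp : p < n) (hρ : 0 < ρ) (hμ : 0 < μ)
    (hgcd : Nat.gcd ρ μ = 1) (α β : Fin n → ℝ) (P : Fin n → TorusComplex.ToroidalSymbol)
    (hP : ∀ (j : Fin n) (ξ : ℤ), ξ ≠ 0 →
      (P j).val ξ = ((α j : ℂ) + Complex.I * (β j : ℂ)) *
        ((|(ξ : ℝ)| ^ ((ρ : ℝ) / (μ : ℝ)) : ℝ) : ℂ)) :
    (β ≠ 0 → TorusComplex.GloballySolvable P p) ∧
    (β = 0 → (TorusComplex.GloballySolvable P p ↔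
      TorusComplex.IsRationalVector α ∨ ¬ TorusComplex.SDA μ α)) := by
  have hn : 0 < n := by omega
  refine ⟨fun hβ => TorusComplex.globallySolvable_of_smallDivisorBound hn
    (TorusComplex.smallDivisorBound_of_im_ne_zero (by positivity) hP hβ), fun hβ => ?_⟩
  have hP' : ∀ (j : Fin n) (ξ : ℤ), ξ ≠ 0 →
      (P j).val ξ = (α j : ℂ) * ((|(ξ : ℝ)| ^ ((ρ : ℝ) / (μ : ℝ)) : ℝ) : ℂ) := fun j ξ hξ => by
    simpa [hβ] using hP j ξ hξ
  constructor
  · intro hS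
    exact Or.inr fun hSDA => TorusComplex.not_smallDivisorBound_of_sda hρ hμ hgcd hP' hSDA
      (TorusComplex.smallDivisorBound_of_globallySolvable hp hS)
  · intro h
    refine TorusComplex.globallySolvable_of_smallDivisorBound hn ?_
    by_contra hA
    have hSDA := TorusComplex.sda_of_not_smallDivisorBound hρ hμ hP' hA
    exact h.elim hSDA.1 fun h' => h' hSDA
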